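/- **Theorem 2 (differential privacy satisfies the axioms).** *Conventions.* Domains $X$ are finite, sample sizes $n$ are positive integers, and a randomized algorithm $M:X^n\to Y$ assigns to each dataset $S\in X^n$ a discrete distribution $M(S)$ on $Y$. $M$ is $(\varepsilon,\delta)$-DP if $\Pr[M(S)\in Y']\le e^{\varepsilon}\Pr[M(S')\in Y']+\delta$ for all $S,S'\in X^n$ differing in only one coordinate and all $Y'\subseteq Y$. For $\alpha>0$ put $$\mathcal P_{\mathrm{DP}}(M)=\Big(\frac{\varepsilon}{\alpha}\Big)^{5/4},\qquad \varepsilon=\text{the least value}\ \ge 0\ \text{such that } M \text{ is } (\varepsilon,\varepsilon^2/n^3)\text{-DP}.$$ $M$ is $\mathcal P_{\mathrm{DP}}$-private if $\mathcal P_{\mathrm{DP}}(M)\le 1$. A statistical task is a set $\mathscr D$ of distributions on $X$ with a set $\mathcal T(\mathcal D)\subseteq Y$ of valid responses for each $\mathcal D\in\mathscr D$; $M$ solves it with failure probability $\beta$ if $\Pr_{S\sim\mathcal D^n}[M(S)\in\mathcal T(\mathcal D)]\ge 1-\beta$ for all $\mathcal D\in\mathscr D$. $M':X^m\to Y$ is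 $(\beta,\beta')$-equivalent to $M:X^n\to Y$ if it solves with failure probability $\beta'$ every task that $M$ solves with failure probability $\beta$. *Statement.* There is a universal constant $0<\alpha_0\le 0.1$ such that for every $0<\alpha\le\alpha_0$ there are constants $C,t,C'>0$ and $\Delta\ge 1$, depending only on $\alpha$, such that for all finite $X$, all $Y$ and all $n\ge 1$: 1. (Preprocessing) For every $M:X^n\to Y$, every permutation $\pi$ of $[n]$ and every map $\sigma:X\to X$, the algorithms $S\mapsto M(S_{\pi(1)},\dots,S_{\pi(n)})$ and $S\mapsto M(\sigma(S_1),\dots,\sigma(S_n))$ have $\mathcal P_{\mathrm{DP}}$ at most $\mathcal P_{\mathrm{DP}}(M)$. 2. (Prohibition of blatant non-privacy) If $M:X^n\to Y$ is $\mathcal P_{\mathrm{DP}}$-private, then for every distribution $\mathcal D$ on $X$ with $\mathcal D(x)\le 1/(100n^2)$ for all $x$, and every randomized $A:Y\to X^n$, $$\mathbb E_{S\sim\mathcal D^n,\;S'\leftarrow A(M(S))}\big[\#\{i\in[n]: S_i\in S'\}\big]<0.9\,n.$$ 3. (Strong composition with $c=5/8$) If $M^1,\dots,M^\ell:X^n\to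 Y$ satisfy $\mathcal P_{\mathrm{DP}}(M^i)\le\epsilon$ for all $i$, and $C\,\epsilon\,\ell^{5/8}(1+\log n)^t\le 1$, then the composed algorithm $S\mapsto(M^1(S),\dots,M^\ell(S))$, run with independent randomness, is $\mathcal P_{\mathrm{DP}}$-private. 4. (Linear scalability with $p(n,1/\beta)=\Delta n^{10}/\beta$) If $M:X^n\to Y$ is $\mathcal P_{\mathrm{DP}}$-private, $0<\beta\le 1$, and $k\ge\Delta n^{10}/\beta$ is an integer, then there is an algorithm $M':X^{kn}\to Y$ that is $(\beta,5\beta)$-equivalent to $M$ and satisfies $\mathcal P_{\mathrm{DP}}(M')\le C'/k$. -/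

import Mathlib

open scoped NNReal ENNReal

universe u v

namespace PrivacyAxioms

/-! ### Discrete probability -/

/-- The real probability of the event `T` under the discrete distribution `p`. -/
noncomputable def prob {A : Type*} (p : PMF A) (T : Set A) : ℝ :=
  (p.toOuterMeasure T).toReal

/-- The expectation of a nonnegative function under the discrete distribution `p`. -/
noncomputable def expect {A : Type*} (p : PMF A) (f : A → ℝ≥0∞) : ℝ≥0∞ :=
  ∑' a, p a * f a

theorem tsum_prod_pmf {A : Type*} :
    ∀ (n : ℕ) (p : Fin n → PMF A), ∑' a : Fin n → A, ∏ i, p i (a i) = 1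
  | 0, p => by
      rw [tsum_eq_single (default : Fin 0 → A)]
      · simp
      · intro b hb
        exact absurd (Subsingleton.elim b default) hb
  | n + 1, p => by
      rw [← (Fin.consEquiv (fun _ : Fin (n + 1) => A)).tsum_eq]
      have h : ∀ x : A × (Fin n → A),
          ∏ i, p i ((Fin.consEquiv (fun _ : Fin (n + 1) => A)) x i)
            = p 0 x.1 * ∏ i : Fin n, p i.succ (x.2 i) := by
        intro x
        simp [Fin.prod_univ_succ, Fin.consEquiv]
      rw [tsum_congr h, ENNReal.tsum_prod']
      simp_rw [ENNReal.tsum_mul_left, tsum_prod_pmf n (fun i => p i.succ), mul_one]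
      exact (p 0).tsum_coe

/-- The joint distribution of independent draws, the `i`-th one from `p i`. -/
noncomputable def indep {A : Type*} {n : ℕ} (p : Fin n → PMF A) : PMF (Fin n → A) :=
  ⟨fun a => ∏ i, p i (a i), by
    have h := (ENNReal.summable (f := fun a : Fin n → A => ∏ i, p i (a i))).hasSum
    rwa [tsum_prod_pmf] at h⟩

/-- `D ^ n`: a sample of `n` independent draws from `D`. -/
noncomputable def iid {A : Type*} (D : PMF A) (n : ℕ) : PMF (Fin n → A) :=
  indep fun _ => D

/-! ### Algorithms, statistical tasks, equivalence -/

/-- A randomized algorithm `X ^ n → Y`: each dataset is sent to a distribution of outputs. -/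
abbrev Algorithm (X : Type u) (Y : Type v) (n : ℕ) : Type (max u v) :=
  (Fin n → X) → PMF Y

/-- A statistical task: a set of distributions over the domain and, for each of them, the set of
valid responses (only the values of `valid` on `dists` matter). -/
structure StatTask (X : Type u) (Y : Type v) where
  dists : Set (PMF X)
  valid : PMF X → Set Y

/-- `M` solves the task `T` with failure probability `β`. -/
def Solves {X : Type u} {Y : Type v} {n : ℕ} (M : Algorithm X Y n) (T : StatTask X Y)
    (β : ℝ) : Prop :=
  ∀ D ∈ T.dists, 1 - β ≤ prob ((iid D n).bind M) (T.valid D)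

/-- `M'` is `(β, β')`-equivalent to `M`. -/
def IsEquivalent {X : Type u} {Y : Type v} {m n : ℕ} (M' : Algorithm X Y m)
    (M : Algorithm X Y n) (β β' : ℝ) : Prop :=
  ∀ T : StatTask X Y, Solves M T β → Solves M' T β'

/-- The non-adaptive composition `S ↦ (M 1 S, …, M ℓ S)`, with independent randomness. -/
noncomputable def compose {X : Type u} {Y : Type v} {n ℓ : ℕ} (M : Fin ℓ → Algorithm X Y n) :
    Algorithm X (Fin ℓ → Y) n :=
  fun S => indep fun i => M i S

/-! ### Blatant non-privacy -/

open Classical in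
/-- The number of indices `i` for which the point `S i` occurs in the dataset `S'`. -/
noncomputable def overlap {X : Type u} {n : ℕ} (S S' : Fin n → X) : ℕ :=
  (Finset.univ.filter fun i => ∃ j, S' j = S i).card

/-- Some randomized adversary recovers, in expectation, at least a `0.9` fraction of a sample
from some distribution with all point masses at most `1 / (100 n ^ 2)`. -/
def BlatantlyNonPrivate {X : Type u} {Y : Type v} {n : ℕ} (M : Algorithm X Y n) : Prop :=
  ∃ D : PMF X, (∀ x, D x ≤ 1 / (100 * (n : ℝ≥0∞) ^ 2)) ∧
    ∃ A : Y → PMF (Fin n → X),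
      (9 / 10 : ℝ≥0∞) * n ≤
        expect (iid D n) fun S => expect ((M S).bind A) fun S' => (overlap S S' : ℝ≥0∞)

/-! ### Privacy measures and the four axioms

Domains are finite, output spaces are arbitrary (with discretely distributed outputs), and sample
sizes are positive. -/

set_option linter.checkUnivs false in
/-- A privacy measure assigns a nonnegative real to every algorithm, for all finite domains, all
output spaces and all sample sizes. -/
def PrivacyMeasure : Type (max (u + 1) (v + 1)) :=
  ∀ (X : Type u) (Y : Type v) (n : ℕ) [Finite X], Algorithm X Y n → ℝ≥0

/-- Preprocessing maintains privacy: reordering the input and remapping the domain. -/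
def Preprocessing (P : PrivacyMeasure.{u, v}) : Prop :=
  ∀ (X : Type u) (Y : Type v) (n : ℕ) [Finite X], 0 < n → ∀ M : Algorithm X Y n,
    (∀ π : Equiv.Perm (Fin n), P X Y n (fun S => M fun i => S (π i)) ≤ P X Y n M) ∧
    (∀ σ : X → X, P X Y n (fun S => M fun i => σ (S i)) ≤ P X Y n M)

/-- Private algorithms are not blatantly non-private. -/
def ProhibitsBlatantNonPrivacy (P : PrivacyMeasure.{u, v}) : Prop :=
  ∀ (X : Type u) (Y : Type v) (n : ℕ) [Finite X], 0 < n → ∀ M : Algorithm X Y n,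
    P X Y n M ≤ 1 → ¬ BlatantlyNonPrivate M

/-- `c`-strong composition. The `O(polylog n)` factor is `C * (1 + log n) ^ t`, with `C` and `t`
depending on the privacy measure and `c` only. -/
def StrongComposition (P : PrivacyMeasure.{u, v}) (c : ℝ) : Prop :=
  c < 1 ∧ ∃ (C : ℝ) (t : ℕ), 0 < C ∧
    ∀ (X : Type u) (Y : Type v) (n ℓ : ℕ) [Finite X], 0 < n →
      ∀ (M : Fin ℓ → Algorithm X Y n) (ε : ℝ≥0), (∀ i, P X Y n (M i) ≤ ε) →
        C * ε * (ℓ : ℝ) ^ c * (1 + Real.log n) ^ t ≤ 1 →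
          P X (Fin ℓ → Y) n (compose M) ≤ 1

/-- Linear scalability with polynomial `p` (in `n` and `1 / β`) and `(β, a β)`-equivalence. The
constant `C` of `O(1 / k)` depends on the privacy measure, `p` and `a` only. -/
def LinearScalability (P : PrivacyMeasure.{u, v}) (p : MvPolynomial (Fin 2) ℝ) (a : ℝ) : Prop :=
  ∃ C : ℝ≥0, ∀ (X : Type u) (Y : Type v) (n : ℕ) [Finite X], 0 < n → ∀ M : Algorithm X Y n,
    P X Y n M ≤ 1 → ∀ β : ℝ, 0 < β → β ≤ 1 → ∀ k : ℕ, 0 < k →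
      MvPolynomial.eval ![(n : ℝ), 1 / β] p ≤ k →
        ∃ M' : Algorithm X Y (k * n), IsEquivalent M' M β (a * β) ∧ P X Y (k * n) M' ≤ C / k

/-! ### Differential privacy -/

/-- `M` is `(ε, δ)`-DP: the output distributions on any two datasets that agree outside one
coordinate are `(ε, δ)`-close on every event. -/
def IsDP {X : Type u} {Y : Type v} {n : ℕ} (M : Algorithm X Y n) (ε δ : ℝ) : Prop :=
  ∀ (S S' : Fin n → X) (i : Fin n), (∀ j, j ≠ i → S j = S' j) →
    ∀ T : Set Y, prob (M S) T ≤ Real.exp ε * prob (M S') T + δ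

/-- The smallest `ε ≥ 0` for which `M` is `(ε, ε ^ 2 / n ^ 3)`-DP; see `dpLevel_isLeast`. -/
noncomputable def dpLevel {X : Type u} {Y : Type v} {n : ℕ} (M : Algorithm X Y n) : ℝ≥0 :=
  sInf {ε : ℝ≥0 | IsDP M ε ((ε : ℝ) ^ 2 / (n : ℝ) ^ 3)}

theorem prob_le_one {A : Type*} (p : PMF A) (T : Set A) : prob p T ≤ 1 := by
  unfold prob
  have h : p.toOuterMeasure T ≤ 1 := by
    rw [PMF.toOuterMeasure_apply, ← p.tsum_coe]
    exact ENNReal.tsum_le_tsum fun a => Set.indicator_le_self' (fun _ _ => zero_le) a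
  simpa using ENNReal.toReal_mono ENNReal.one_ne_top h

/-- The infimum in the definition of `dpLevel` is attained. -/
theorem dpLevel_isLeast {X : Type u} {Y : Type v} {n : ℕ} (M : Algorithm X Y n) :
    IsLeast {ε : ℝ≥0 | IsDP M ε ((ε : ℝ) ^ 2 / (n : ℝ) ^ 3)} (dpLevel M) := by
  have hclosed : IsClosed {ε : ℝ≥0 | IsDP M ε ((ε : ℝ) ^ 2 / (n : ℝ) ^ 3)} := by
    have h : {ε : ℝ≥0 | IsDP M ε ((ε : ℝ) ^ 2 / (n : ℝ) ^ 3)} =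
        ⋂ (S : Fin n → X) (S' : Fin n → X) (i : Fin n) (_ : ∀ j, j ≠ i → S j = S' j)
          (T : Set Y), {ε : ℝ≥0 | prob (M S) T ≤
            Real.exp (ε : ℝ) * prob (M S') T + (ε : ℝ) ^ 2 / (n : ℝ) ^ 3} := by
      ext ε
      simp [IsDP]
    rw [h]
    refine isClosed_iInter fun S => isClosed_iInter fun S' => isClosed_iInter fun i =>
      isClosed_iInter fun _ => isClosed_iInter fun T => isClosed_le (by fun_prop) (by fun_prop)
  have hne : {ε : ℝ≥0 | IsDP M ε ((ε : ℝ) ^ 2 / (n : ℝ) ^ 3)}.Nonempty := by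
    refine ⟨(n : ℝ≥0) ^ 2, ?_⟩
    intro S S' i _ T
    have hn : (1 : ℝ) ≤ n := by exact_mod_cast i.pos
    have h1 : (1 : ℝ) ≤ (((n : ℝ≥0) ^ 2 : ℝ≥0) : ℝ) ^ 2 / (n : ℝ) ^ 3 := by
      rw [le_div_iff₀ (by positivity)]
      push_cast
      nlinarith [pow_pos (lt_of_lt_of_le one_pos hn) 3]
    have h2 := prob_le_one (M S) T
    have h3 : 0 ≤ Real.exp (((n : ℝ≥0) ^ 2 : ℝ≥0) : ℝ) * prob (M S') T :=
      mul_nonneg (Real.exp_pos _).le ENNReal.toReal_nonneg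
    linarith
  exact hclosed.isLeast_csInf hne (OrderBot.bddBelow _)

/-- The privacy measure `(ε / α) ^ (5 / 4)`, with `ε` the least value such that the algorithm is
`(ε, ε ^ 2 / n ^ 3)`-DP. -/
noncomputable def dpMeasure (α : ℝ≥0) : PrivacyMeasure.{u, v} :=
  fun _ _ _ _ M => (dpLevel M / α) ^ (5 / 4 : ℝ)

end PrivacyAxioms

namespace PrivacyAxioms

/-! Preprocessing holds because a permutation of positions or a map of the domain sends neighbouring
datasets to neighbouring datasets. For blatant non-privacy (`not_blatantlyNonPrivate`), exchange the
sample point `S i` with a fresh draw. The joint law is unchanged, privacy bounds the effect on the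
adversary, and a set of `n` guesses contains a fresh point with probability at most `n / (100 n ^
2)`.

For composition (`prob_indep_le`), replace each output mass `p` by `min p (e q)`. This loses total
mass at most `ℓ δ`. The `m`-th moment of the truncated likelihood ratio under `q` is `1 + O(m² ε²)`,
because the first-order term is at most zero after summation. Moments multiply over independent
coordinates, so Markov's inequality bounds the part where the product of ratios exceeds `exp a`.
This permits `ℓ ε²` of order one up to logarithms, that is, a loss of `ℓ ^ (1/2)` in `ε`; the
exponent `5/4` in the measure turns it into `ℓ ^ (5/8)`.

For scalability, write `k = K ^ 10`. The target is the level `α / K ^ 8`, whose measure is exactly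
`1 / k`. The data are cut into disjoint blocks of `n × n` points, and in each block `M` is averaged
over all ways of picking one point per row. Changing one point of a block moves the averaged output
probabilities by a relative amount of about `α / n`. The Efron–Stein inequality applied to their
square roots therefore bounds the total variance by `O(α²)` over all `n²` points
(`sum_variance_sqrt_le`). By Chebyshev, for most outputs `y`, measured by their overall probability
`p y`, a typical block gives `y` mass at least `4/5 * p y`; by Chernoff, nine tenths of the blocks
do so simultaneously with overwhelming probability.

The blocks are then merged by a soft quantile: the weight of `y` is the supremum of `c * w t`, where
`t` counts the blocks giving `y` mass at least `c` and `w` decays exponentially below nine tenths of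
the blocks. One block shifts `t` by at most one, so after normalization the output is private at the
far smaller level set by the decay of `w` (`isDP_boost`). Typical outputs keep a constant total
weight, while the expected weight of invalid outputs is at most a constant times the original
failure probability plus a small term (`isEquivalent_boost`). -/

/-! ### Basic inequalities for events and approximate indistinguishability. -/

theorem toOuterMeasure_le_one {A : Type*} (p : PMF A) (T : Set A) : p.toOuterMeasure T ≤ 1 := by
  rw [PMF.toOuterMeasure_apply, ← p.tsum_coe]
  exact ENNReal.tsum_le_tsum fun a => Set.indicator_le_self' (fun _ _ => zero_le) a

theorem toOuterMeasure_ne_top {A : Type*} (p : PMF A) (T : Set A) : p.toOuterMeasure T ≠ ∞ :=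
  ((toOuterMeasure_le_one p T).trans_lt ENNReal.one_lt_top).ne

theorem prob_nonneg {A : Type*} (p : PMF A) (T : Set A) : 0 ≤ prob p T := ENNReal.toReal_nonneg

theorem ofReal_prob {A : Type*} (p : PMF A) (T : Set A) :
    ENNReal.ofReal (prob p T) = p.toOuterMeasure T :=
  ENNReal.ofReal_toReal (toOuterMeasure_ne_top p T)

/-- The probabilities of `T` are `(ε, δ)`-close in the extended nonnegative reals. -/
theorem prob_le_iff {A : Type*} (p q : PMF A) (T : Set A) {ε δ : ℝ} (hδ : 0 ≤ δ) :
    prob p T ≤ Real.exp ε * prob q T + δ ↔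
      p.toOuterMeasure T ≤
        ENNReal.ofReal (Real.exp ε) * q.toOuterMeasure T + ENNReal.ofReal δ := by
  rw [← ofReal_prob, ← ofReal_prob, ← ENNReal.ofReal_mul (Real.exp_pos _).le,
    ← ENNReal.ofReal_add (mul_nonneg (Real.exp_pos _).le (prob_nonneg _ _)) hδ,
    ENNReal.ofReal_le_ofReal_iff]
  exact add_nonneg (mul_nonneg (Real.exp_pos _).le (prob_nonneg _ _)) hδ

/-- The event where `p` exceeds `e q` is the worst one, and testing it gives the whole excess mass.
This pointwise form of privacy is what expectations, composition and subsampling use. -/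
theorem tsum_tsub_le_of_prob_le {A : Type*} (p q : PMF A) {ε δ : ℝ} (hδ : 0 ≤ δ)
    (h : ∀ T : Set A, prob p T ≤ Real.exp ε * prob q T + δ) :
    ∑' a, (p a - ENNReal.ofReal (Real.exp ε) * q a) ≤ ENNReal.ofReal δ := by
  set e := ENNReal.ofReal (Real.exp ε)
  have he : e ≠ ∞ := ENNReal.ofReal_ne_top
  set T : Set A := {a | e * q a < p a}
  have h1 := (prob_le_iff p q T hδ).1 (h T)
  rw [PMF.toOuterMeasure_apply, PMF.toOuterMeasure_apply, ← ENNReal.tsum_mul_left] at h1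
  have hfin : ∑' a, e * T.indicator q a ≠ ∞ := by
    rw [ENNReal.tsum_mul_left, ← PMF.toOuterMeasure_apply]
    exact ENNReal.mul_ne_top he (toOuterMeasure_ne_top _ _)
  have h2 : ∑' a, T.indicator p a
      = ∑' a, (p a - e * q a) + ∑' a, e * T.indicator q a := by
    rw [← ENNReal.tsum_add]
    refine tsum_congr fun a => ?_
    by_cases ha : a ∈ T
    · rw [Set.indicator_of_mem ha, Set.indicator_of_mem ha]
      exact (tsub_add_cancel_of_le (le_of_lt ha)).symm
    · rw [Set.indicator_of_notMem ha, Set.indicator_of_notMem ha]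
      have : p a ≤ e * q a := not_lt.1 ha
      simp [tsub_eq_zero_of_le this]
  rw [h2, add_comm (∑' a, e * T.indicator q a)] at h1
  exact (ENNReal.add_le_add_iff_right hfin).1 h1

theorem IsDP.tsum_tsub_le {X : Type u} {Y : Type v} {n : ℕ} {M : Algorithm X Y n} {ε δ : ℝ}
    (h : IsDP M ε δ) (hδ : 0 ≤ δ) {S S' : Fin n → X} {i : Fin n} (hS : ∀ j, j ≠ i → S j = S' j) :
    ∑' y, (M S y - ENNReal.ofReal (Real.exp ε) * M S' y) ≤ ENNReal.ofReal δ :=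
  tsum_tsub_le_of_prob_le _ _ hδ (h S S' i hS)

/-- Differential privacy for expectations of `[0, 1]`-valued functions of the output. -/
theorem IsDP.expect_le {X : Type u} {Y : Type v} {n : ℕ} {M : Algorithm X Y n} {ε δ : ℝ}
    (h : IsDP M ε δ) (hδ : 0 ≤ δ) {S S' : Fin n → X} {i : Fin n} (hS : ∀ j, j ≠ i → S j = S' j)
    {φ : Y → ℝ≥0∞} (hφ : ∀ y, φ y ≤ 1) :
    expect (M S) φ ≤ ENNReal.ofReal (Real.exp ε) * expect (M S') φ + ENNReal.ofReal δ := by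
  unfold expect
  rw [← ENNReal.tsum_mul_left]
  refine le_trans ?_ (add_le_add_right (h.tsum_tsub_le hδ hS) _)
  rw [← ENNReal.tsum_add]
  refine ENNReal.tsum_le_tsum fun y => ?_
  calc M S y * φ y
      ≤ (ENNReal.ofReal (Real.exp ε) * M S' y
          + (M S y - ENNReal.ofReal (Real.exp ε) * M S' y)) * φ y := by
        gcongr; exact le_add_tsub
    _ ≤ _ := by
        rw [add_mul, mul_assoc]
        gcongr
        exact mul_le_of_le_one_right' (hφ y)

theorem IsDP.mono {X : Type u} {Y : Type v} {n : ℕ} {M : Algorithm X Y n} {ε δ ε' δ' : ℝ}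
    (h : IsDP M ε δ) (hε : ε ≤ ε') (hδ : δ ≤ δ') : IsDP M ε' δ' := fun S S' i hS T =>
  (h S S' i hS T).trans (add_le_add
    (mul_le_mul_of_nonneg_right (Real.exp_le_exp.2 hε) (prob_nonneg _ _)) hδ)

theorem isDP_of_dpLevel_le {X : Type u} {Y : Type v} {n : ℕ} {M : Algorithm X Y n} {ε : ℝ≥0}
    (h : dpLevel M ≤ ε) : IsDP M ε ((ε : ℝ) ^ 2 / (n : ℝ) ^ 3) :=
  IsDP.mono (dpLevel_isLeast M).1 (by exact_mod_cast h) (by gcongr)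

theorem dpLevel_le {X : Type u} {Y : Type v} {n : ℕ} {M : Algorithm X Y n} {ε : ℝ≥0}
    (h : IsDP M ε ((ε : ℝ) ^ 2 / (n : ℝ) ^ 3)) : dpLevel M ≤ ε :=
  (dpLevel_isLeast M).2 h

theorem dpMeasure_le_one_iff {X : Type u} {Y : Type v} {n : ℕ} [Finite X] {M : Algorithm X Y n}
    {α : ℝ≥0} (hα : 0 < α) : dpMeasure.{u, v} α X Y n M ≤ 1 ↔ dpLevel M ≤ α := by
  unfold dpMeasure
  have h : ((dpLevel M / α) ^ (5 / 4 : ℝ) ≤ 1 ↔ dpLevel M / α ≤ 1) := by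
    conv_lhs => rw [← NNReal.one_rpow (5 / 4 : ℝ)]
    exact NNReal.rpow_le_rpow_iff (by norm_num)
  rw [h, div_le_one hα]

/-! ### Preprocessing. -/

theorem preprocessing_dpMeasure (α : ℝ≥0) : Preprocessing (dpMeasure.{u, v} α) := by
  intro X Y n _ _ M
  have key : ∀ g : (Fin n → X) → (Fin n → X),
      (∀ S S' : Fin n → X, ∀ i, (∀ j, j ≠ i → S j = S' j) →
        ∃ i', ∀ j, j ≠ i' → g S j = g S' j) →
      dpMeasure.{u, v} α X Y n (fun S => M (g S)) ≤ dpMeasure.{u, v} α X Y n M := by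
    intro g hg
    unfold dpMeasure
    gcongr
    refine dpLevel_le fun S S' i hS T => ?_
    obtain ⟨i', hi'⟩ := hg S S' i hS
    exact (dpLevel_isLeast M).1 (g S) (g S') i' hi' T
  refine ⟨fun π => key (fun S i => S (π i)) ?_, fun σ => key (fun S i => σ (S i)) ?_⟩
  · intro S S' i hS
    refine ⟨π.symm i, fun j hj => hS _ fun h => hj ?_⟩
    rw [← h, Equiv.symm_apply_apply]
  · exact fun S S' i hS => ⟨i, fun j hj => congrArg σ (hS j hj)⟩

/-! ### Exchange with a fresh draw, and blatant non-privacy. -/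

/-- Exchange a coordinate with a fresh draw. -/
def swapCoord {X : Type u} {n : ℕ} (i : Fin n) : (Fin n → X) × X ≃ (Fin n → X) × X where
  toFun q := (Function.update q.1 i q.2, q.1 i)
  invFun q := (Function.update q.1 i q.2, q.1 i)
  left_inv q := by simp
  right_inv q := by simp

theorem iid_apply {A : Type*} (D : PMF A) (n : ℕ) (S : Fin n → A) :
    iid D n S = ∏ i, D (S i) := rfl

theorem iid_update_mul {X : Type u} (D : PMF X) {n : ℕ} (S : Fin n → X) (i : Fin n) (x : X) :
    iid D n (Function.update S i x) * D (S i) = iid D n S * D x := by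
  have h (S : Fin n → X) : iid D n S = D (S i) * ∏ j ∈ Finset.univ.erase i, D (S j) := by
    rw [iid_apply, Finset.mul_prod_erase _ (fun j => D (S j)) (Finset.mem_univ i)]
  have h2 : ∏ j ∈ Finset.univ.erase i, D (Function.update S i x j)
      = ∏ j ∈ Finset.univ.erase i, D (S j) :=
    Finset.prod_congr rfl fun j hj => by
      rw [Function.update_of_ne (Finset.ne_of_mem_erase hj)]
  rw [h, h S, h2, Function.update_self]
  ring

/-- The exchange of `S i` and `x` is an involution that preserves the product weight of `n + 1`
independent draws. -/
theorem expect_iid_swap {X : Type u} (D : PMF X) {n : ℕ} (i : Fin n)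
    (g : (Fin n → X) → X → ℝ≥0∞) :
    (expect (iid D n) fun S => expect D fun x => g (Function.update S i x) (S i))
      = expect (iid D n) fun S => expect D fun x => g S x := by
  unfold expect
  simp_rw [← ENNReal.tsum_mul_left]
  rw [← ENNReal.tsum_prod, ← ENNReal.tsum_prod, ← (swapCoord i).tsum_eq]
  refine tsum_congr fun q => ?_
  simp only [swapCoord, Equiv.coe_fn_mk, Function.update_idem, Function.update_eq_self,
    Function.update_self]
  rw [← mul_assoc, ← mul_assoc, iid_update_mul]

theorem expect_mono {A : Type*} (p : PMF A) {f g : A → ℝ≥0∞} (h : ∀ a, f a ≤ g a) :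
    expect p f ≤ expect p g :=
  ENNReal.tsum_le_tsum fun a => mul_le_mul_right (h a) _

theorem expect_const {A : Type*} (p : PMF A) (c : ℝ≥0∞) : expect p (fun _ => c) = c := by
  simp [expect, ENNReal.tsum_mul_right, p.tsum_coe]

theorem expect_mul_add {A : Type*} (p : PMF A) (f : A → ℝ≥0∞) (c d : ℝ≥0∞) :
    expect p (fun a => c * f a + d) = c * expect p f + d := by
  nth_rw 2 [← expect_const p d]
  unfold expect
  rw [← ENNReal.tsum_mul_left, ← ENNReal.tsum_add]
  exact tsum_congr fun a => by ring

theorem expect_sum {A ι : Type*} (p : PMF A) (s : Finset ι) (f : ι → A → ℝ≥0∞) :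
    expect p (fun a => ∑ i ∈ s, f i a) = ∑ i ∈ s, expect p (f i) := by
  unfold expect
  simp_rw [Finset.mul_sum]
  exact Summable.tsum_finsetSum fun _ _ => ENNReal.summable

theorem expect_comm {A B : Type*} (p : PMF A) (q : PMF B) (f : A → B → ℝ≥0∞) :
    (expect p fun a => expect q fun b => f a b) = expect q fun b => expect p fun a => f a b := by
  unfold expect
  simp_rw [← ENNReal.tsum_mul_left]
  rw [ENNReal.tsum_comm]
  exact tsum_congr fun b => tsum_congr fun a => by ring

theorem expect_bind {A B : Type*} (p : PMF A) (q : A → PMF B) (f : B → ℝ≥0∞) :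
    expect (p.bind q) f = expect p fun a => expect (q a) f := by
  unfold expect
  simp_rw [PMF.bind_apply, ← ENNReal.tsum_mul_right, ← ENNReal.tsum_mul_left]
  rw [ENNReal.tsum_comm]
  exact tsum_congr fun b => tsum_congr fun a => by ring

open Classical in
theorem expect_indicator_mem_le {X : Type u} [Finite X] (D : PMF X) {n : ℕ} {b : ℝ≥0∞}
    (hD : ∀ x, D x ≤ b) (S' : Fin n → X) :
    expect D (fun x => if ∃ j, S' j = x then 1 else 0) ≤ n * b := by
  calc expect D (fun x => if ∃ j, S' j = x then 1 else 0)
      ≤ expect D (fun x => ∑ j : Fin n, if S' j = x then 1 else 0) := by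
        refine expect_mono _ fun x => ?_
        split_ifs with h
        · obtain ⟨j, hj⟩ := h
          refine le_trans ?_ (Finset.single_le_sum (f := fun j => if S' j = x then (1 : ℝ≥0∞) else 0)
            (fun _ _ => zero_le) (Finset.mem_univ j))
          simp [hj]
        · exact zero_le
    _ = ∑ j : Fin n, D (S' j) := by
        rw [expect_sum]
        refine Finset.sum_congr rfl fun j _ => ?_
        unfold expect
        rw [tsum_eq_single (S' j)]
        · simp
        · intro x hx; simp [hx.symm]
    _ ≤ ∑ _j : Fin n, b := Finset.sum_le_sum fun j _ => hD _
    _ = n * b := by simp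

/-- Fix `i` and let `φ x y` be the chance that the adversary, seeing `y`, outputs a dataset
containing `x`. Privacy replaces `M S` by `M` on the dataset with `S i` resampled, and the exchange
then makes the tested point independent of the data. A union bound over the `n` guessed points
finishes each coordinate; summing over `i` gives the left side of `hsmall`. -/
theorem not_blatantlyNonPrivate {X : Type u} {Y : Type v} {n : ℕ} [Finite X] (hn : 0 < n)
    {M : Algorithm X Y n} {ε δ : ℝ} (h : IsDP M ε δ) (hδ : 0 ≤ δ)
    (hsmall : Real.exp ε / 100 + n * δ < 9 / 10 * n) : ¬ BlatantlyNonPrivate M := by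
  classical
  rintro ⟨D, hD, A, hA⟩
  set b : ℝ≥0∞ := 1 / (100 * (n : ℝ≥0∞) ^ 2)
  set e := ENNReal.ofReal (Real.exp ε)
  let φ : X → Y → ℝ≥0∞ := fun x y => expect (A y) fun S' => if ∃ j, S' j = x then 1 else 0
  have hφ : ∀ x y, φ x y ≤ 1 := fun x y =>
    (expect_mono _ fun S' => by split_ifs <;> simp).trans (expect_const (A y) 1).le
  have hov : ∀ S S' : Fin n → X,
      (overlap S S' : ℝ≥0∞) = ∑ i, if ∃ j, S' j = S i then (1 : ℝ≥0∞) else 0 := by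
    intro S S'
    rw [overlap, Finset.sum_boole]
  have h1 : ∀ i : Fin n, (expect (iid D n) fun S => expect (M S) (φ (S i)))
      ≤ e * (n * b) + ENNReal.ofReal δ := by
    intro i
    calc (expect (iid D n) fun S => expect (M S) (φ (S i)))
        = expect (iid D n) fun S => expect D fun _ => expect (M S) (φ (S i)) := by
          simp_rw [expect_const]
      _ ≤ expect (iid D n) fun S => expect D fun x =>
            e * expect (M (Function.update S i x)) (φ (S i)) + ENNReal.ofReal δ := by
          refine expect_mono _ fun S => expect_mono _ fun x => ?_
          exact h.expect_le hδ (i := i) (fun j hj => (Function.update_of_ne hj _ _).symm) (hφ _)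
      _ = expect (iid D n) fun S => expect D fun x =>
            e * expect (M S) (φ x) + ENNReal.ofReal δ :=
          expect_iid_swap D i fun S x => e * expect (M S) (φ x) + ENNReal.ofReal δ
      _ = e * (expect (iid D n) fun S => expect D fun x => expect (M S) (φ x))
            + ENNReal.ofReal δ := by
          simp_rw [expect_mul_add]
      _ ≤ e * (expect (iid D n) fun _ => n * b) + ENNReal.ofReal δ := by
          gcongr
          refine expect_mono _ fun S => ?_
          rw [expect_comm]
          refine (expect_mono _ fun y => ?_).trans (expect_const (M S) _).le
          rw [expect_comm]
          exact (expect_mono _ fun S' => expect_indicator_mem_le D hD S').trans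
            (expect_const (A y) _).le
      _ = _ := by rw [expect_const]
  have h2 : (expect (iid D n) fun S => expect ((M S).bind A) fun S' => (overlap S S' : ℝ≥0∞))
      ≤ n * (e * (n * b) + ENNReal.ofReal δ) := by
    simp_rw [hov, expect_sum, expect_bind]
    refine (Finset.sum_le_sum fun i _ => h1 i).trans ?_
    simp [mul_add]
  have h3 := hA.trans h2
  have hn' : (0 : ℝ) < n := by exact_mod_cast hn
  have hb : b = ENNReal.ofReal (1 / (100 * (n : ℝ) ^ 2)) := by
    rw [ENNReal.ofReal_div_of_pos (by positivity), ENNReal.ofReal_mul (by norm_num),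
      ENNReal.ofReal_pow (by positivity)]
    simp [b]
  have h4 : (n : ℝ≥0∞) * (e * (n * b) + ENNReal.ofReal δ)
      = ENNReal.ofReal (Real.exp ε / 100 + n * δ) := by
    have hnn : (n : ℝ≥0∞) = ENNReal.ofReal n := by simp
    rw [hb, hnn, ← ENNReal.ofReal_mul (by positivity), ← ENNReal.ofReal_mul (by positivity),
      ← ENNReal.ofReal_add (by positivity) hδ, ← ENNReal.ofReal_mul (by positivity)]
    congr 1
    field_simp
  have h5 : (9 / 10 : ℝ≥0∞) * n = ENNReal.ofReal (9 / 10 * n) := by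
    rw [ENNReal.ofReal_mul (by norm_num), ENNReal.ofReal_div_of_pos (by norm_num)]
    simp
  rw [h4, h5, ENNReal.ofReal_le_ofReal_iff (by positivity)] at h3
  linarith

theorem prohibitsBlatantNonPrivacy_dpMeasure {α : ℝ≥0} (hα : 0 < α) (hα1 : α ≤ 1 / 10) :
    ProhibitsBlatantNonPrivacy (dpMeasure.{u, v} α) := by
  intro X Y n _ hn M hM
  have h := isDP_of_dpLevel_le ((dpMeasure_le_one_iff hα).1 hM)
  have hα' : (α : ℝ) ≤ 1 / 10 := by exact_mod_cast hα1
  have hn' : (1 : ℝ) ≤ n := by exact_mod_cast hn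
  refine not_blatantlyNonPrivate hn h (by positivity) ?_
  have h1 : Real.exp (α : ℝ) ≤ 3 :=
    (Real.exp_le_exp.2 (hα'.trans (by norm_num : (1 / 10 : ℝ) ≤ 1))).trans
      (Real.exp_one_lt_d9.le.trans (by norm_num))
  have h2 : (n : ℝ) * ((α : ℝ) ^ 2 / (n : ℝ) ^ 3) ≤ 1 / 100 := by
    calc (n : ℝ) * ((α : ℝ) ^ 2 / (n : ℝ) ^ 3) = (α : ℝ) ^ 2 / (n : ℝ) ^ 2 := by
          field_simp
      _ ≤ (α : ℝ) ^ 2 := div_le_self (by positivity) (one_le_pow₀ hn')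
      _ ≤ (1 / 10) ^ 2 := by gcongr
      _ = _ := by norm_num
  linarith

/-! ### Strong composition through moments of truncated likelihood ratios. -/

theorem tsum_pi_prod {A : Type*} :
    ∀ (n : ℕ) (f : Fin n → A → ℝ≥0∞), ∑' a : Fin n → A, ∏ i, f i (a i) = ∏ i, ∑' x, f i x
  | 0, f => by
      rw [tsum_eq_single (default : Fin 0 → A)]
      · simp
      · intro b hb
        exact absurd (Subsingleton.elim b default) hb
  | n + 1, f => by
      rw [← (Fin.consEquiv (fun _ : Fin (n + 1) => A)).tsum_eq]
      have h : ∀ x : A × (Fin n → A),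
          ∏ i, f i ((Fin.consEquiv (fun _ : Fin (n + 1) => A)) x i)
            = f 0 x.1 * ∏ i : Fin n, f i.succ (x.2 i) := by
        intro x
        simp [Fin.prod_univ_succ, Fin.consEquiv]
      rw [tsum_congr h, ENNReal.tsum_prod']
      simp_rw [ENNReal.tsum_mul_left, tsum_pi_prod n (fun i => f i.succ)]
      rw [ENNReal.tsum_mul_right, Fin.prod_univ_succ]

/-- A quadratic upper bound for powers on `[0, e]`. -/
theorem pow_le_quadratic {x e : ℝ} (hx : 0 ≤ x) (hxe : x ≤ e) (he : 1 ≤ e) (m : ℕ) :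
    x ^ m ≤ 1 + m * (x - 1) + (m : ℝ) ^ 2 * e ^ m * (x - 1) ^ 2 := by
  induction m with
  | zero => simp
  | succ m ih =>
    have h1 : x ^ (m + 1) ≤ x * (1 + m * (x - 1) + (m : ℝ) ^ 2 * e ^ m * (x - 1) ^ 2) := by
      rw [pow_succ, mul_comm]; exact mul_le_mul_of_nonneg_left ih hx
    have h2 : x * ((m : ℝ) ^ 2 * e ^ m * (x - 1) ^ 2)
        ≤ (m : ℝ) ^ 2 * (e ^ (m + 1) * (x - 1) ^ 2) := by
      calc x * ((m : ℝ) ^ 2 * e ^ m * (x - 1) ^ 2)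
          ≤ e * ((m : ℝ) ^ 2 * e ^ m * (x - 1) ^ 2) := by gcongr
        _ = _ := by ring
    have h3 : (x - 1) ^ 2 ≤ e ^ (m + 1) * (x - 1) ^ 2 :=
      le_mul_of_one_le_left (by positivity) (one_le_pow₀ he)
    have h4 : (m : ℝ) * (x - 1) ^ 2 ≤ m * (e ^ (m + 1) * (x - 1) ^ 2) := by gcongr
    have h5 : 0 ≤ (m : ℝ) * (e ^ (m + 1) * (x - 1) ^ 2) := by positivity
    have h6 : 0 ≤ e ^ (m + 1) * (x - 1) ^ 2 := by positivity
    calc x ^ (m + 1) ≤ _ := h1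
      _ = x * ((m : ℝ) ^ 2 * e ^ m * (x - 1) ^ 2) + m * (x - 1) ^ 2
          + (1 + (m + 1) * (x - 1)) := by ring
      _ ≤ (m : ℝ) ^ 2 * (e ^ (m + 1) * (x - 1) ^ 2) + (2 * (m * (e ^ (m + 1) * (x - 1) ^ 2))
          + e ^ (m + 1) * (x - 1) ^ 2) + (1 + (m + 1) * (x - 1)) := by linarith
      _ = _ := by push_cast; ring

/-- Truncation bounds `x` only from above. Below `1 / e` the deviation `1 - x` is at most `(1 - e x)
+ (e - 1)`, and since `1 - e x ≤ 1` its square may be charged linearly to the mass on which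
closeness fails in the reverse direction. -/
theorem sq_sub_one_le {x e : ℝ} (hx : 0 ≤ x) (hxe : x ≤ e) (he : 1 ≤ e) :
    (x - 1) ^ 2 ≤ 2 * (e - 1) ^ 2 + 2 * max 0 (1 - e * x) := by
  rcases le_total 1 x with h | h
  · nlinarith [le_max_left 0 (1 - e * x)]
  · rcases le_total (1 - e * x) 0 with h' | h'
    · rw [max_eq_left h']
      have : 1 - x ≤ e - 1 := by nlinarith
      nlinarith
    · rw [max_eq_right h']
      have h1 : 1 - x ≤ (1 - e * x) + (e - 1) := by nlinarith
      have h2 : 1 - e * x ≤ 1 := by nlinarith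
      nlinarith [sq_nonneg ((1 - e * x) - (e - 1))]

/-- Multiply the quadratic bound for `x ^ m` by `q`. The linear term uses `q x ≤ p`, so it
contributes at most `m (p - q)`, which sums to zero over two probability distributions. The term `m
q` stands on the left so that every summand is nonnegative and the sum can be taken in the extended
reals. -/
theorem moment_pointwise {p q e : ℝ} (hp : 0 ≤ p) (hq : 0 ≤ q) (he : 1 ≤ e) (m : ℕ) :
    q * (min p (e * q) / q) ^ m + m * q
      ≤ q + m * p + (m : ℝ) ^ 2 * e ^ m * (2 * (e - 1) ^ 2 * q + 2 * max 0 (q - e * p)) := by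
  rcases hq.eq_or_lt with rfl | hq
  · have : 0 ≤ (m : ℝ) * p := by positivity
    have h2 : (0 : ℝ) ≤ (m : ℝ) ^ 2 * e ^ m * (2 * max 0 (0 - e * p)) := by positivity
    simp only [zero_mul, mul_zero, zero_add]
    linarith
  set x := min p (e * q) / q with hx
  have hqx : q * x = min p (e * q) := by rw [hx]; field_simp
  have hx0 : 0 ≤ x := by positivity
  have hxe : x ≤ e := by rw [hx, div_le_iff₀ hq]; exact min_le_right _ _
  have h1 := mul_le_mul_of_nonneg_left (pow_le_quadratic hx0 hxe he m) hq.le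
  have h2 := mul_le_mul_of_nonneg_left (sq_sub_one_le hx0 hxe he) hq.le
  have h3 : q * max 0 (1 - e * x) ≤ max 0 (q - e * p) := by
    rw [mul_max_of_nonneg _ _ hq.le, mul_zero]
    refine max_le (le_max_left _ _) ?_
    have : q * (1 - e * x) = q - e * min p (e * q) := by rw [← hqx]; ring
    rw [this]
    rcases min_cases p (e * q) with ⟨h, _⟩ | ⟨h, _⟩
    · rw [h]; exact le_max_right _ _
    · rw [h]
      refine le_trans ?_ (le_max_left _ _)
      nlinarith
  have h4 : q * (x - 1) ^ 2 ≤ 2 * (e - 1) ^ 2 * q + 2 * max 0 (q - e * p) := by nlinarith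
  have h5 := mul_le_mul_of_nonneg_left h4 (by positivity : (0 : ℝ) ≤ (m : ℝ) ^ 2 * e ^ m)
  have h6 : (m : ℝ) * (q * x) ≤ m * p := by
    rw [hqx]; exact mul_le_mul_of_nonneg_left (min_le_left _ _) (by positivity)
  nlinarith

theorem toReal_tsub_le {a b : ℝ≥0∞} (ha : a ≠ ∞) (hb : b ≠ ∞) :
    ENNReal.ofReal (max 0 (a.toReal - b.toReal)) = a - b := by
  rw [← ENNReal.ofReal_toReal ha, ← ENNReal.ofReal_toReal hb,
    ← ENNReal.ofReal_sub _ ENNReal.toReal_nonneg, ENNReal.toReal_ofReal ENNReal.toReal_nonneg,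
    ENNReal.toReal_ofReal ENNReal.toReal_nonneg]
  rcases le_total (a.toReal - b.toReal) 0 with h | h
  · rw [max_eq_left h, ENNReal.ofReal_of_nonpos h, ENNReal.ofReal_zero]
  · rw [max_eq_right h]

/-- The `m`-th moment, under `q`, of the ratio of the truncation `min p (e q)` and `q`. -/
noncomputable def truncMoment (e : ℝ) (m : ℕ) (p q : ℝ) : ℝ := q * (min p (e * q) / q) ^ m

theorem tsum_truncMoment_le {Y : Type*} (P Q : PMF Y) {ε δ : ℝ} (hε : 0 ≤ ε) (hδ : 0 ≤ δ)
    (h : ∑' y, (Q y - ENNReal.ofReal (Real.exp ε) * P y) ≤ ENNReal.ofReal δ) (m : ℕ) :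
    ∑' y, ENNReal.ofReal (truncMoment (Real.exp ε) m (P y).toReal (Q y).toReal)
      ≤ ENNReal.ofReal
        (1 + (m : ℝ) ^ 2 * Real.exp ε ^ m * (2 * (Real.exp ε - 1) ^ 2 + 2 * δ)) := by
  set e := Real.exp ε
  have he : 1 ≤ e := Real.one_le_exp hε
  set K : ℝ := (m : ℝ) ^ 2 * e ^ m
  have hK : 0 ≤ K := by positivity
  have hpt : ∀ y, ENNReal.ofReal (truncMoment e m (P y).toReal (Q y).toReal) + m * Q y
      ≤ Q y + m * P y + ENNReal.ofReal K * (ENNReal.ofReal (2 * (e - 1) ^ 2) * Q y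
          + 2 * (Q y - ENNReal.ofReal e * P y)) := by
    intro y
    have hp := ENNReal.toReal_nonneg (a := P y)
    have hq := ENNReal.toReal_nonneg (a := Q y)
    have hP : P y = ENNReal.ofReal (P y).toReal := (ENNReal.ofReal_toReal (P.apply_ne_top y)).symm
    have hQ : Q y = ENNReal.ofReal (Q y).toReal := (ENNReal.ofReal_toReal (Q.apply_ne_top y)).symm
    have hm : (m : ℝ≥0∞) = ENNReal.ofReal m := by simp
    have h2 : (2 : ℝ≥0∞) = ENNReal.ofReal 2 := by simp
    have hsub : Q y - ENNReal.ofReal e * P y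
        = ENNReal.ofReal (max 0 ((Q y).toReal - e * (P y).toReal)) := by
      rw [← toReal_tsub_le (Q.apply_ne_top y)
        (ENNReal.mul_ne_top ENNReal.ofReal_ne_top (P.apply_ne_top y)), ENNReal.toReal_mul,
        ENNReal.toReal_ofReal (by positivity)]
    have h0 : 0 ≤ truncMoment e m (P y).toReal (Q y).toReal := by
      unfold truncMoment; positivity
    rw [hsub, hm, h2]
    nth_rw 2 [hQ]
    nth_rw 3 [hQ]
    nth_rw 2 [hP]
    nth_rw 4 [hQ]
    rw [← ENNReal.ofReal_mul (by positivity), ← ENNReal.ofReal_mul (by positivity),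
      ← ENNReal.ofReal_mul (by positivity), ← ENNReal.ofReal_mul (by positivity),
      ← ENNReal.ofReal_add (by positivity) (by positivity),
      ← ENNReal.ofReal_add (by positivity) (by positivity),
      ← ENNReal.ofReal_add (by positivity) (by positivity),
      ← ENNReal.ofReal_mul (by positivity),
      ← ENNReal.ofReal_add (by positivity) (by positivity)]
    exact ENNReal.ofReal_le_ofReal (moment_pointwise hp hq he m)
  have hsum := ENNReal.tsum_le_tsum hpt
  simp only [ENNReal.tsum_add, ENNReal.tsum_mul_left, P.tsum_coe, Q.tsum_coe, mul_one] at hsum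
  have h3 : ∑' y, ENNReal.ofReal (truncMoment e m (P y).toReal (Q y).toReal) + m
      ≤ ENNReal.ofReal (1 + K * (2 * (e - 1) ^ 2 + 2 * δ)) + m := by
    refine hsum.trans ?_
    rw [ENNReal.ofReal_add (by norm_num) (by positivity), ENNReal.ofReal_mul hK,
      ENNReal.ofReal_add (by positivity) (by positivity), ENNReal.ofReal_mul (q := δ) (by norm_num),
      ENNReal.ofReal_one, add_right_comm]
    gcongr
    simp
  exact (ENNReal.add_le_add_iff_right (ENNReal.natCast_ne_top m)).1 h3

/-- Markov's inequality pointwise: where the ratio of the products exceeds `exp a`, its `k`-th power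
exceeds `exp (a k)`, and the left side is absorbed by the moment of order `k + 1`. Where some `q i`
vanishes, so does the truncated product. -/
theorem prod_min_le {ℓ : ℕ} {p q : Fin ℓ → ℝ} (hp : ∀ i, 0 ≤ p i) (hq : ∀ i, 0 ≤ q i)
    {e : ℝ} (he : 0 ≤ e) (a : ℝ) (k : ℕ) :
    ∏ i, min (p i) (e * q i) ≤ Real.exp a * ∏ i, q i
      + Real.exp (-(a * k)) * ∏ i, truncMoment e (k + 1) (p i) (q i) := by
  set T := ∏ i, min (p i) (e * q i) with hT
  set Q := ∏ i, q i with hQ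
  have hmin : ∀ i, 0 ≤ min (p i) (e * q i) := fun i => le_min (hp i) (mul_nonneg he (hq i))
  have hT0 : 0 ≤ T := Finset.prod_nonneg fun i _ => hmin i
  have hQ0 : 0 ≤ Q := Finset.prod_nonneg fun i _ => hq i
  have hmom : ∏ i, truncMoment e (k + 1) (p i) (q i) = Q * (T / Q) ^ (k + 1) := by
    unfold truncMoment
    rw [Finset.prod_mul_distrib, Finset.prod_pow, Finset.prod_div_distrib]
  rw [hmom]
  have h0 : 0 ≤ Real.exp (-(a * k)) * (Q * (T / Q) ^ (k + 1)) := by positivity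
  rcases le_or_gt T (Real.exp a * Q) with h | h
  · linarith
  · have hQpos : 0 < Q := by
      refine Finset.prod_pos fun i _ => lt_of_le_of_ne (hq i) fun h0 => ?_
      have : T = 0 := Finset.prod_eq_zero (Finset.mem_univ i) (by
        rw [← h0, mul_zero]; exact min_eq_right (hp i))
      rw [this] at h
      exact absurd h (not_lt.2 (by positivity))
    have h1 : Real.exp a ≤ T / Q := (le_div_iff₀ hQpos).2 h.le
    have h2 : Real.exp (a * k) ≤ (T / Q) ^ k := by
      rw [mul_comm, Real.exp_nat_mul]; gcongr
    have h3 : Q * (T / Q) ^ (k + 1) = T * (T / Q) ^ k := by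
      rw [pow_succ]; field_simp
    rw [h3]
    have h4 : T ≤ Real.exp (-(a * k)) * (T * (T / Q) ^ k) := by
      calc T = Real.exp (-(a * k)) * (T * Real.exp (a * k)) := by
            rw [mul_left_comm, ← Real.exp_add]; simp
        _ ≤ _ := by gcongr
    have h5 : 0 ≤ Real.exp a * Q := by positivity
    linarith

theorem tsum_tsub {A : Type*} {f g : A → ℝ≥0∞} (hg : ∑' a, g a ≠ ∞) (h : ∀ a, g a ≤ f a) :
    ∑' a, (f a - g a) = ∑' a, f a - ∑' a, g a := by
  refine ENNReal.eq_sub_of_add_eq hg ?_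
  rw [← ENNReal.tsum_add]
  exact tsum_congr fun a => tsub_add_cancel_of_le (h a)

theorem one_sub_le_tsum_min {Y : Type*} (P Q : PMF Y) {e δ : ℝ}
    (h : ∑' y, (P y - ENNReal.ofReal e * Q y) ≤ ENNReal.ofReal δ) :
    1 - ENNReal.ofReal δ ≤ ∑' y, min (P y) (ENNReal.ofReal e * Q y) := by
  rw [tsub_le_iff_right, ← P.tsum_coe]
  refine le_trans ?_ (add_le_add_right h _)
  rw [← ENNReal.tsum_add]
  refine ENNReal.tsum_le_tsum fun y => ?_
  rcases min_cases (P y) (ENNReal.ofReal e * Q y) with ⟨h, _⟩ | ⟨h, _⟩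
  · rw [h]; exact le_self_add
  · rw [h]; exact le_add_tsub

theorem indep_apply {A : Type*} {n : ℕ} (p : Fin n → PMF A) (a : Fin n → A) :
    indep p a = ∏ i, p i (a i) := rfl

/-- Advanced composition of approximately indistinguishable distributions. -/
theorem prob_indep_le {Y : Type*} {ℓ : ℕ} (P Q : Fin ℓ → PMF Y) {ε δ : ℝ} (hε : 0 ≤ ε)
    (hδ : 0 ≤ δ) (hδ1 : δ ≤ 1)
    (hPQ : ∀ i, ∑' y, (P i y - ENNReal.ofReal (Real.exp ε) * Q i y) ≤ ENNReal.ofReal δ)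
    (hQP : ∀ i, ∑' y, (Q i y - ENNReal.ofReal (Real.exp ε) * P i y) ≤ ENNReal.ofReal δ)
    (a : ℝ) (k : ℕ) (T : Set (Fin ℓ → Y)) :
    prob (indep P) T ≤ Real.exp a * prob (indep Q) T
      + (Real.exp (-(a * k)) * (1 + ((k + 1 : ℕ) : ℝ) ^ 2 * Real.exp ε ^ (k + 1)
          * (2 * (Real.exp ε - 1) ^ 2 + 2 * δ)) ^ ℓ + ℓ * δ) := by
  set e := Real.exp ε
  have he : 1 ≤ e := Real.one_le_exp hε
  set c : ℝ := 1 + ((k + 1 : ℕ) : ℝ) ^ 2 * e ^ (k + 1) * (2 * (e - 1) ^ 2 + 2 * δ)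
  have hc : 0 ≤ c := by positivity
  rw [prob_le_iff _ _ _ (by positivity)]
  let t : Fin ℓ → Y → ℝ≥0∞ := fun i y => min (P i y) (ENNReal.ofReal e * Q i y)
  have ht : ∀ i y, t i y = ENNReal.ofReal (min (P i y).toReal (e * (Q i y).toReal)) := by
    intro i y
    rw [ENNReal.ofReal_min, ENNReal.ofReal_mul (by positivity),
      ENNReal.ofReal_toReal ((P i).apply_ne_top y), ENNReal.ofReal_toReal ((Q i).apply_ne_top y)]
  have htop : ∀ y : Fin ℓ → Y, ∏ i, t i (y i) ≠ ∞ := fun y => by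
    refine ENNReal.prod_ne_top fun i _ => ?_
    rw [ht]; exact ENNReal.ofReal_ne_top
  have htle : ∀ y : Fin ℓ → Y, ∏ i, t i (y i) ≤ indep P y := fun y =>
    Finset.prod_le_prod' fun i _ => min_le_left _ _
  have htsum : ∑' y : Fin ℓ → Y, ∏ i, t i (y i) ≠ ∞ := by
    refine ne_top_of_le_ne_top ENNReal.one_ne_top ?_
    rw [← (indep P).tsum_coe]
    exact ENNReal.tsum_le_tsum htle
  -- the truncation loses little mass
  have hloss : ∑' y : Fin ℓ → Y, (indep P y - ∏ i, t i (y i)) ≤ ENNReal.ofReal (ℓ * δ) := by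
    rw [tsum_tsub htsum htle, (indep P).tsum_coe, tsum_pi_prod, tsub_le_iff_right]
    calc (1 : ℝ≥0∞) = ENNReal.ofReal 1 := by simp
      _ ≤ ENNReal.ofReal (ℓ * δ + (1 - δ) ^ ℓ) := by
          refine ENNReal.ofReal_le_ofReal ?_
          have := one_add_mul_le_pow (by linarith : (-2 : ℝ) ≤ -δ) ℓ
          rw [← sub_eq_add_neg] at this
          linarith
      _ = ENNReal.ofReal (ℓ * δ) + ENNReal.ofReal (1 - δ) ^ ℓ := by
          rw [ENNReal.ofReal_add (by positivity) (pow_nonneg (by linarith) _),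
            ENNReal.ofReal_pow (by linarith)]
      _ ≤ _ := by
          gcongr
          calc ENNReal.ofReal (1 - δ) ^ ℓ = ∏ _i : Fin ℓ, ENNReal.ofReal (1 - δ) := by simp
            _ ≤ _ := Finset.prod_le_prod' fun i _ => by
              rw [ENNReal.ofReal_sub _ hδ, ENNReal.ofReal_one]
              exact one_sub_le_tsum_min (P i) (Q i) (hPQ i)
  -- the truncation is dominated up to a moment bound
  have hdom : ∀ y : Fin ℓ → Y, ∏ i, t i (y i) ≤ ENNReal.ofReal (Real.exp a) * indep Q y
      + ENNReal.ofReal (Real.exp (-(a * k))) * ∏ i, ENNReal.ofReal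
          (truncMoment e (k + 1) (P i (y i)).toReal (Q i (y i)).toReal) := by
    intro y
    have hm0 : ∀ i, 0 ≤ truncMoment e (k + 1) (P i (y i)).toReal (Q i (y i)).toReal := fun i => by
      unfold truncMoment
      have := ENNReal.toReal_nonneg (a := P i (y i))
      have := ENNReal.toReal_nonneg (a := Q i (y i))
      positivity
    have hQy : indep Q y = ENNReal.ofReal (∏ i, (Q i (y i)).toReal) := by
      rw [ENNReal.ofReal_prod_of_nonneg fun _ _ => ENNReal.toReal_nonneg, indep_apply]
      exact Finset.prod_congr rfl fun i _ =>
        (ENNReal.ofReal_toReal ((Q i).apply_ne_top (y i))).symm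
    have hq0 : 0 ≤ ∏ i, (Q i (y i)).toReal :=
      Finset.prod_nonneg fun _ _ => ENNReal.toReal_nonneg
    rw [hQy, ← ENNReal.ofReal_prod_of_nonneg fun i _ => hm0 i,
      ← ENNReal.ofReal_mul (by positivity), ← ENNReal.ofReal_mul (by positivity),
      ← ENNReal.ofReal_add (by positivity)
        (mul_nonneg (by positivity) (Finset.prod_nonneg fun i _ => hm0 i)),
      Finset.prod_congr rfl fun i _ => ht i (y i),
      ← ENNReal.ofReal_prod_of_nonneg fun i _ =>
        le_min ENNReal.toReal_nonneg (mul_nonneg (by positivity) ENNReal.toReal_nonneg)]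
    exact ENNReal.ofReal_le_ofReal (prod_min_le (fun _ => ENNReal.toReal_nonneg)
      (fun _ => ENNReal.toReal_nonneg) (by positivity) a k)
  have hmom : ∑' y : Fin ℓ → Y, ∏ i, ENNReal.ofReal
      (truncMoment e (k + 1) (P i (y i)).toReal (Q i (y i)).toReal) ≤ ENNReal.ofReal (c ^ ℓ) := by
    rw [tsum_pi_prod ℓ fun i y => ENNReal.ofReal
      (truncMoment e (k + 1) (P i y).toReal (Q i y).toReal)]
    calc _ ≤ ∏ _i : Fin ℓ, ENNReal.ofReal c := Finset.prod_le_prod' fun i _ =>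
          tsum_truncMoment_le (P i) (Q i) hε hδ (hQP i) (k + 1)
      _ = _ := by simp [ENNReal.ofReal_pow hc]
  have hpt : ∀ y, T.indicator (indep P) y ≤ ENNReal.ofReal (Real.exp a) * T.indicator (indep Q) y
      + (ENNReal.ofReal (Real.exp (-(a * k))) * ∏ i, ENNReal.ofReal
          (truncMoment e (k + 1) (P i (y i)).toReal (Q i (y i)).toReal)
        + (indep P y - ∏ i, t i (y i))) := by
    intro y
    by_cases hy : y ∈ T
    · rw [Set.indicator_of_mem hy, Set.indicator_of_mem hy, ← add_assoc]
      calc indep P y = ∏ i, t i (y i) + (indep P y - ∏ i, t i (y i)) :=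
            (add_tsub_cancel_of_le (htle y)).symm
        _ ≤ _ := add_le_add_left (hdom y) _
    · rw [Set.indicator_of_notMem hy]; exact zero_le
  rw [PMF.toOuterMeasure_apply, PMF.toOuterMeasure_apply]
  refine (ENNReal.tsum_le_tsum hpt).trans ?_
  rw [ENNReal.tsum_add, ENNReal.tsum_add, ENNReal.tsum_mul_left, ENNReal.tsum_mul_left,
    ENNReal.ofReal_add (by positivity) (by positivity), ENNReal.ofReal_mul (by positivity)]
  gcongr

theorem IsDP.compose {X : Type u} {Y : Type v} {n ℓ : ℕ} {M : Fin ℓ → Algorithm X Y n} {ε δ : ℝ}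
    (h : ∀ i, IsDP (M i) ε δ) (hε : 0 ≤ ε) (hδ : 0 ≤ δ) (hδ1 : δ ≤ 1) (a : ℝ) (k : ℕ) :
    IsDP (compose M) a (Real.exp (-(a * k)) * (1 + ((k + 1 : ℕ) : ℝ) ^ 2 * Real.exp ε ^ (k + 1)
          * (2 * (Real.exp ε - 1) ^ 2 + 2 * δ)) ^ ℓ + ℓ * δ) := fun _ _ _ hS T =>
  prob_indep_le _ _ hε hδ hδ1 (fun i => (h i).tsum_tsub_le hδ hS)
    (fun i => (h i).tsum_tsub_le hδ fun j hj => (hS j hj).symm) a k T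

/-- The order `k` is about `A L`, with `α A = 4 + 2 |log α|`, so that `exp (-α k)` beats `α² / N³`
with room for constants. The factor `100` in `D` keeps `k E` and `ℓ k² E²` small, so the product of
the moments stays below `exp 1`. Each of the two error terms takes half of the budget. -/
theorem composition_delta_le {α E L N D A : ℝ} {ℓ k : ℕ} (hα : 0 < α) (hα1 : α ≤ 1) (hE : 0 ≤ E)
    (hN : 1 ≤ N) (hL : L = 1 + Real.log N) (hA : A = (4 + 2 * |Real.log α|) / α)
    (hD : D = 100 * A) (hk : k = ⌈A * L⌉₊) (hEL : E * L ≤ α / D)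
    (hEl : ℓ * (E * L) ^ 2 ≤ (α / D) ^ 2) :
    Real.exp (-(α * k)) * (1 + ((k + 1 : ℕ) : ℝ) ^ 2 * Real.exp E ^ (k + 1)
          * (2 * (Real.exp E - 1) ^ 2 + 2 * (E ^ 2 / N ^ 3))) ^ ℓ + ℓ * (E ^ 2 / N ^ 3)
      ≤ α ^ 2 / N ^ 3 := by
  have hlog : 0 ≤ Real.log N := Real.log_nonneg hN
  have hL1 : 1 ≤ L := by linarith
  have hαA : α * A = 4 + 2 * |Real.log α| := by rw [hA]; field_simp
  have hA4 : 4 ≤ A := by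
    rw [hA, le_div_iff₀ hα]; nlinarith [abs_nonneg (Real.log α)]
  have hDpos : 0 < D := by linarith
  have hαD : α / D ≤ 1 / (100 * A) := by rw [hD]; gcongr
  have hEL' : E * L * A ≤ 1 / 100 := by
    calc E * L * A ≤ 1 / (100 * A) * A := by gcongr; exact hEL.trans hαD
      _ = 1 / 100 := by field_simp
  have hE1 : E ≤ 1 / 400 := by
    have : E * 1 * 4 ≤ E * L * A := by gcongr
    linarith
  have hAL : 4 ≤ A * L := by nlinarith
  have hkge : A * L ≤ k := by rw [hk]; exact Nat.le_ceil _
  have hkle : ((k + 1 : ℕ) : ℝ) ≤ 2 * (A * L) := by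
    have := Nat.ceil_lt_add_one (by linarith : 0 ≤ A * L)
    rw [← hk] at this
    push_cast
    linarith
  have hexp1 : Real.exp E - 1 ≤ 2 * E := by
    have := Real.abs_exp_sub_one_le (x := E) (by rw [abs_of_nonneg hE]; linarith)
    rw [abs_of_nonneg hE] at this
    exact (le_abs_self _).trans this
  have hexp0 : 0 ≤ Real.exp E - 1 := by linarith [Real.one_le_exp hE]
  have hexpm : Real.exp E ^ (k + 1) ≤ 3 := by
    rw [← Real.exp_nat_mul]
    have : ((k + 1 : ℕ) : ℝ) * E ≤ 1 := by
      calc ((k + 1 : ℕ) : ℝ) * E ≤ 2 * (A * L) * E := by gcongr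
        _ = 2 * (E * L * A) := by ring
        _ ≤ 1 := by linarith
    exact (Real.exp_le_exp.2 this).trans (Real.exp_one_lt_d9.le.trans (by norm_num))
  have hN3 : (1 : ℝ) ≤ N ^ 3 := one_le_pow₀ hN
  have hδ : E ^ 2 / N ^ 3 ≤ E ^ 2 := div_le_self (by positivity) hN3
  set c := ((k + 1 : ℕ) : ℝ) ^ 2 * Real.exp E ^ (k + 1)
          * (2 * (Real.exp E - 1) ^ 2 + 2 * (E ^ 2 / N ^ 3)) with hc
  have hc0 : 0 ≤ c := by positivity
  have hcle : c ≤ (2 * (A * L)) ^ 2 * 3 * (2 * (2 * E) ^ 2 + 2 * E ^ 2) := by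
    rw [hc]; gcongr
  have hlc : (ℓ : ℝ) * c ≤ 1 := by
    calc (ℓ : ℝ) * c ≤ ℓ * ((2 * (A * L)) ^ 2 * 3 * (2 * (2 * E) ^ 2 + 2 * E ^ 2)) := by gcongr
      _ = 120 * A ^ 2 * (ℓ * (E * L) ^ 2) := by ring
      _ ≤ 120 * A ^ 2 * (1 / (100 * A)) ^ 2 := by
          gcongr
          exact hEl.trans (by gcongr)
      _ = 120 / 10000 := by field_simp; norm_num
      _ ≤ 1 := by norm_num
  have hpow : (1 + c) ^ ℓ ≤ Real.exp 1 := by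
    calc (1 + c) ^ ℓ ≤ Real.exp c ^ ℓ := by
          gcongr; linarith [Real.add_one_le_exp c]
      _ = Real.exp (ℓ * c) := (Real.exp_nat_mul _ _).symm
      _ ≤ Real.exp 1 := Real.exp_le_exp.2 hlc
  have hfirst : Real.exp (-(α * k)) * (1 + c) ^ ℓ ≤ α ^ 2 / N ^ 3 / 2 := by
    have h1 : 4 + 2 * |Real.log α| + 4 * Real.log N ≤ α * k := by
      calc 4 + 2 * |Real.log α| + 4 * Real.log N
          ≤ (4 + 2 * |Real.log α|) * (1 + Real.log N) := by
            nlinarith [mul_nonneg (abs_nonneg (Real.log α)) hlog]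
        _ = α * (A * L) := by rw [← hαA, hL]; ring
        _ ≤ α * k := by gcongr
    have h2 : α ^ 2 / N ^ 3 = Real.exp (2 * Real.log α - 3 * Real.log N) := by
      rw [Real.exp_sub, show (2 : ℝ) * Real.log α = (2 : ℕ) * Real.log α by norm_num,
        show (3 : ℝ) * Real.log N = (3 : ℕ) * Real.log N by norm_num, Real.exp_nat_mul,
        Real.exp_nat_mul, Real.exp_log hα, Real.exp_log (by linarith)]
    have h3 : Real.exp (-1) ≤ 1 / 2 := by
      rw [Real.exp_neg, one_div]
      exact inv_anti₀ (by norm_num) (by linarith [Real.exp_one_gt_d9])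
    calc Real.exp (-(α * k)) * (1 + c) ^ ℓ ≤ Real.exp (-(α * k)) * Real.exp 1 := by gcongr
      _ = Real.exp (-(α * k) + 1) := (Real.exp_add _ _).symm
      _ ≤ Real.exp (2 * Real.log α - 3 * Real.log N + -1) := by
          refine Real.exp_le_exp.2 ?_
          linarith [neg_abs_le (Real.log α)]
      _ = α ^ 2 / N ^ 3 * Real.exp (-1) := by rw [Real.exp_add, h2]
      _ ≤ α ^ 2 / N ^ 3 * (1 / 2) := by gcongr
      _ = _ := by ring
  have hsecond : (ℓ : ℝ) * (E ^ 2 / N ^ 3) ≤ α ^ 2 / N ^ 3 / 2 := by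
    calc (ℓ : ℝ) * (E ^ 2 / N ^ 3) = ℓ * (E * 1) ^ 2 / N ^ 3 := by ring
      _ ≤ ℓ * (E * L) ^ 2 / N ^ 3 := by gcongr
      _ ≤ (α / D) ^ 2 / N ^ 3 := by gcongr
      _ ≤ (α / 2) ^ 2 / N ^ 3 := by gcongr; linarith
      _ ≤ _ := by
          rw [div_div, mul_comm, ← div_div]
          gcongr
          nlinarith [sq_nonneg α]
  linarith

theorem dpLevel_le_of_dpMeasure_le {X : Type u} {Y : Type v} {n : ℕ} [Finite X]
    {M : Algorithm X Y n} {α ε : ℝ≥0} (hα : 0 < α) (h : dpMeasure.{u, v} α X Y n M ≤ ε) :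
    dpLevel M ≤ α * ε ^ (4 / 5 : ℝ) := by
  have h1 : dpLevel M / α ≤ ε ^ (4 / 5 : ℝ) := by
    calc dpLevel M / α = ((dpLevel M / α) ^ (5 / 4 : ℝ)) ^ (4 / 5 : ℝ) := by
          rw [← NNReal.rpow_mul]; norm_num
      _ ≤ ε ^ (4 / 5 : ℝ) := NNReal.rpow_le_rpow h (by norm_num)
  rwa [div_le_iff₀ hα, mul_comm] at h1

theorem strongComposition_dpMeasure {α : ℝ≥0} (hα : 0 < α) (hα1 : α ≤ 1) :
    StrongComposition (dpMeasure.{u, v} α) (5 / 8) := by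
  have hα' : (0 : ℝ) < α := by exact_mod_cast hα
  have hα1' : (α : ℝ) ≤ 1 := by exact_mod_cast hα1
  set A : ℝ := (4 + 2 * |Real.log α|) / α with hA
  have hApos : 0 < A := by positivity
  set D : ℝ := 100 * A with hD
  have hDpos : 0 < D := by positivity
  -- The hypothesis will be raised to the power `4/5`: `D ^ (5/4)` becomes `D`, `ℓ ^ (5/8)` becomes
  -- `ℓ ^ (1/2)`, and the squared logarithmic factor becomes its power `8/5`, which is enough since
  -- only the first power is needed.
  refine ⟨by norm_num, D ^ (5 / 4 : ℝ), 2, by positivity, ?_⟩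
  intro X Y n ℓ _ hn M ε hM hsmall
  rw [dpMeasure_le_one_iff hα]
  refine dpLevel_le ?_
  -- For `ℓ = 0` the hypothesis says nothing about `ε`, but the composed output is constant.
  rcases Nat.eq_zero_or_pos ℓ with rfl | hℓ
  · intro S S' i hS T
    have h1 : compose M S = compose M S' := by
      unfold compose; congr 1; funext i; exact i.elim0
    rw [h1]
    have h2 := Real.one_le_exp α.2
    have h3 := prob_nonneg (compose M S') T
    have h4 : (0 : ℝ) ≤ (α : ℝ) ^ 2 / (n : ℝ) ^ 3 := by positivity
    change (1 : ℝ) ≤ Real.exp (α : ℝ) at h2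
    nlinarith
  · have hn' : (1 : ℝ) ≤ n := by exact_mod_cast hn
    have hℓ' : (1 : ℝ) ≤ ℓ := by exact_mod_cast hℓ
    set L : ℝ := 1 + Real.log n with hL
    have hL1 : 1 ≤ L := by linarith [Real.log_nonneg hn']
    set e : ℝ := (ε : ℝ) ^ (4 / 5 : ℝ) with he
    have he0 : 0 ≤ e := by positivity
    set E : ℝ := α * e with hE
    have hE0 : 0 ≤ E := by positivity
    have hpow : D * e * (ℓ : ℝ) ^ (1 / 2 : ℝ) * (L ^ 2) ^ (4 / 5 : ℝ) ≤ 1 := by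
      have h := Real.rpow_le_rpow (by positivity) hsmall (by norm_num : (0 : ℝ) ≤ 4 / 5)
      rw [Real.one_rpow, Real.mul_rpow (by positivity) (by positivity),
        Real.mul_rpow (by positivity) (by positivity),
        Real.mul_rpow (by positivity) (by positivity), ← Real.rpow_mul (by positivity),
        ← Real.rpow_mul (by positivity)] at h
      norm_num at h
      norm_num
      exact h
    have hLL : L ≤ (L ^ 2) ^ (4 / 5 : ℝ) := by
      rw [← Real.rpow_natCast, ← Real.rpow_mul (by positivity)]
      exact Real.self_le_rpow_of_one_le hL1 (by norm_num)
    have hsq : D * e * (ℓ : ℝ) ^ (1 / 2 : ℝ) * L ≤ 1 :=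
      le_trans (by gcongr) hpow
    have hsqrt : ((ℓ : ℝ) ^ (1 / 2 : ℝ)) ^ 2 = ℓ := by
      rw [← Real.sqrt_eq_rpow, Real.sq_sqrt (by positivity)]
    have hEl : (ℓ : ℝ) * (E * L) ^ 2 ≤ (α / D) ^ 2 := by
      calc (ℓ : ℝ) * (E * L) ^ 2 = (α / D) ^ 2 * (D * e * (ℓ : ℝ) ^ (1 / 2 : ℝ) * L) ^ 2 := by
            rw [mul_pow (D * e * (ℓ : ℝ) ^ (1 / 2 : ℝ)) L, mul_pow (D * e), hsqrt, hE]
            field_simp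
        _ ≤ (α / D) ^ 2 * 1 ^ 2 := by gcongr
        _ = _ := by ring
    have hEL : E * L ≤ α / D := by
      refine le_of_sq_le_sq ?_ (by positivity)
      refine le_trans ?_ hEl
      exact le_mul_of_one_le_left (by positivity) hℓ'
    have hDP : ∀ i, IsDP (M i) E (E ^ 2 / (n : ℝ) ^ 3) := fun i => by
      have h := isDP_of_dpLevel_le (dpLevel_le_of_dpMeasure_le hα (hM i))
      simpa [hE, he] using h
    have hE1 : E ≤ 1 := by
      have h1 : E * 1 ≤ E * L := by gcongr
      have h2 : (α : ℝ) / D ≤ 1 := by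
        rw [div_le_one hDpos, hD, hA]
        rw [← mul_div_assoc, le_div_iff₀ hα']
        nlinarith [abs_nonneg (Real.log α)]
      linarith
    have hδ1 : E ^ 2 / (n : ℝ) ^ 3 ≤ 1 := by
      rw [div_le_one (by positivity)]
      exact (pow_le_one₀ hE0 hE1).trans (one_le_pow₀ hn')
    exact (IsDP.compose hDP hE0 (by positivity) hδ1 α ⌈A * L⌉₊).mono le_rfl
      (composition_delta_le hα' hα1' hE0 hn' hL hA hD rfl hEL hEl)

/-! ### Averages over finite product spaces and the Efron–Stein inequality. -/

section Avg

variable {X : Type*} [Fintype X] {ι κ : Type*} [Fintype ι] [DecidableEq ι] [Fintype κ]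
  [DecidableEq κ]

/-- The expectation of `f` when the coordinates are drawn independently with weights `d`. -/
def avg (d : X → ℝ) (f : (ι → X) → ℝ) : ℝ := ∑ S : ι → X, (∏ i, d (S i)) * f S

theorem avg_add (d : X → ℝ) (f g : (ι → X) → ℝ) :
    avg d (fun S => f S + g S) = avg d f + avg d g := by
  simp [avg, mul_add, Finset.sum_add_distrib]

theorem avg_mul_left (d : X → ℝ) (c : ℝ) (f : (ι → X) → ℝ) :
    avg d (fun S => c * f S) = c * avg d f := by
  simp only [avg, Finset.mul_sum]
  exact Finset.sum_congr rfl fun S _ => by ring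

theorem avg_sub (d : X → ℝ) (f g : (ι → X) → ℝ) :
    avg d (fun S => f S - g S) = avg d f - avg d g := by
  simp [avg, mul_sub, Finset.sum_sub_distrib]

theorem avg_sum {σ : Type*} (s : Finset σ) (d : X → ℝ) (f : σ → (ι → X) → ℝ) :
    avg d (fun S => ∑ j ∈ s, f j S) = ∑ j ∈ s, avg d (f j) := by
  simp only [avg, Finset.mul_sum]
  exact Finset.sum_comm

theorem avg_prod (d : X → ℝ) (g : ι → X → ℝ) :
    avg d (fun S => ∏ i, g i (S i)) = ∏ i, ∑ x, d x * g i x := by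
  simp only [avg, ← Finset.prod_mul_distrib]
  rw [Finset.prod_univ_sum, Fintype.piFinset_univ]

theorem avg_const {d : X → ℝ} (hd : ∑ x, d x = 1) (c : ℝ) :
    avg d (fun _ : ι → X => c) = c := by
  have h := avg_prod (ι := ι) d fun _ _ => 1
  have h2 := avg_mul_left (ι := ι) d c fun _ => 1
  simp only [mul_one, Finset.prod_const_one, hd] at h h2
  rw [h2, h, mul_one]

theorem avg_mono {d : X → ℝ} (hd : ∀ x, 0 ≤ d x) {f g : (ι → X) → ℝ} (h : ∀ S, f S ≤ g S) :
    avg d f ≤ avg d g :=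
  Finset.sum_le_sum fun S _ =>
    mul_le_mul_of_nonneg_left (h S) (Finset.prod_nonneg fun _ _ => hd _)

theorem avg_nonneg {d : X → ℝ} (hd : ∀ x, 0 ≤ d x) {f : (ι → X) → ℝ} (h : ∀ S, 0 ≤ f S) :
    0 ≤ avg d f :=
  Finset.sum_nonneg fun S _ => mul_nonneg (Finset.prod_nonneg fun _ _ => hd _) (h S)

theorem avg_comp_equiv (d : X → ℝ) (φ : ι ≃ κ) (f : (ι → X) → ℝ) :
    avg d (fun S : κ → X => f (fun i => S (φ i))) = avg d f := by
  unfold avg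
  refine Fintype.sum_equiv (φ.symm.arrowCongr (Equiv.refl X)) _ _ fun S => ?_
  have : (φ.symm.arrowCongr (Equiv.refl X)) S = fun i => S (φ i) := by
    funext i; simp [Equiv.arrowCongr]
  rw [this, φ.prod_comp fun i => d (S i)]

theorem avg_sumElim {d : X → ℝ} (hd : ∑ x, d x = 1) (f : (ι → X) → ℝ) :
    avg d (fun S : ι ⊕ κ → X => f (fun i => S (Sum.inl i))) = avg d f := by
  unfold avg
  rw [← (Equiv.sumArrowEquivProdArrow ι κ X).symm.sum_comp, Fintype.sum_prod_type]
  refine Finset.sum_congr rfl fun S _ => ?_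
  have h := avg_const (ι := κ) hd (f S)
  unfold avg at h
  conv_rhs => rw [← h]
  rw [Finset.mul_sum]
  refine Finset.sum_congr rfl fun T _ => ?_
  simp [Equiv.sumArrowEquivProdArrow, Fintype.prod_sum_type, mul_assoc]

/-- Restricting an independent sample along an injection gives an independent sample. -/
theorem avg_comp_injective {d : X → ℝ} (hd : ∑ x, d x = 1) {φ : ι → κ}
    (hφ : Function.Injective φ) (f : (ι → X) → ℝ) :
    avg d (fun S : κ → X => f (fun i => S (φ i))) = avg d f := by
  classical
  let e : ι ⊕ {k // k ∉ Set.range φ} ≃ κ :=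
    (Equiv.sumCongr (Equiv.ofInjective φ hφ) (Equiv.refl _)).trans
      (Equiv.Set.sumCompl (Set.range φ))
  have he : ∀ i, e (Sum.inl i) = φ i := fun i => by
    simp only [e, Equiv.trans_apply, Equiv.sumCongr_apply, Sum.map_inl]
    exact Equiv.Set.sumCompl_apply_inl _ _
  have h1 := avg_comp_equiv d e fun S : ι ⊕ {k // k ∉ Set.range φ} → X =>
    f fun i => S (Sum.inl i)
  simp only [he] at h1
  rw [h1, avg_sumElim hd]

theorem avg_cons (d : X → ℝ) {N : ℕ} (f : (Fin (N + 1) → X) → ℝ) :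
    avg d f = ∑ x, d x * avg d fun S => f (Fin.cons x S) := by
  unfold avg
  rw [← (Fin.consEquiv fun _ : Fin (N + 1) => X).sum_comp, Fintype.sum_prod_type]
  refine Finset.sum_congr rfl fun x _ => ?_
  rw [Finset.mul_sum]
  refine Finset.sum_congr rfl fun S _ => ?_
  simp [Fin.consEquiv, Fin.prod_univ_succ, mul_assoc]

theorem avg_sq_le {d : X → ℝ} (hd0 : ∀ x, 0 ≤ d x) (hd : ∑ x, d x = 1) (f : (ι → X) → ℝ) :
    avg d f ^ 2 ≤ avg d fun S => f S ^ 2 := by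
  have h : 0 ≤ avg d fun S => (f S - avg d f) ^ 2 := avg_nonneg hd0 fun S => sq_nonneg _
  have h2 : (fun S => (f S - avg d f) ^ 2)
      = fun S => f S ^ 2 - 2 * avg d f * f S + avg d f ^ 2 := by funext S; ring
  rw [h2, avg_add, avg_sub, avg_mul_left, avg_const hd] at h
  nlinarith

/-- The Efron–Stein inequality. -/
theorem efronStein_fin {d : X → ℝ} (hd0 : ∀ x, 0 ≤ d x) (hd : ∑ x, d x = 1) :
    ∀ {N : ℕ} (f : (Fin N → X) → ℝ),
      (avg d fun S => f S ^ 2) - avg d f ^ 2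
        ≤ 1 / 2 * ∑ i, avg d fun S => ∑ x, d x * (f S - f (Function.update S i x)) ^ 2
  | 0, f => by simp [avg]
  | N + 1, f => by
      have ih := fun x => efronStein_fin hd0 hd fun S : Fin N → X => f (Fin.cons x S)
      rw [avg_cons d f, avg_cons d fun S => f S ^ 2, Fin.sum_univ_succ]
      set h : X → ℝ := fun x => avg d fun S => f (Fin.cons x S) with hh
      -- Law of total variance, conditioning on the first coordinate: the induction hypothesis
      -- bounds each conditional variance, and `h2` rewrites the variance of the conditional mean
      -- `h` as half a mean squared difference of two independent copies.
      have h1 : ∑ x, d x * (avg d fun S => f (Fin.cons x S) ^ 2) ≤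
          ∑ x, d x * h x ^ 2 + ∑ x, d x * (1 / 2 * ∑ i, avg d fun S => ∑ x', d x' *
            (f (Fin.cons x S) - f (Fin.cons x (Function.update S i x'))) ^ 2) := by
        rw [← Finset.sum_add_distrib]
        refine Finset.sum_le_sum fun x _ => ?_
        rw [← mul_add]
        refine mul_le_mul_of_nonneg_left ?_ (hd0 x)
        linarith [ih x]
      have h2 : ∑ x, d x * h x ^ 2 - (∑ x, d x * h x) ^ 2
          = 1 / 2 * ∑ x, d x * ∑ x', d x' * (h x - h x') ^ 2 := by
        have e1 : ∀ x, ∑ x', d x' * (h x - h x') ^ 2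
            = h x ^ 2 - 2 * h x * (∑ x', d x' * h x') + ∑ x', d x' * h x' ^ 2 := by
          intro x
          calc ∑ x', d x' * (h x - h x') ^ 2
              = ∑ x', (h x ^ 2 * d x' - 2 * h x * (d x' * h x') + d x' * h x' ^ 2) :=
                Finset.sum_congr rfl fun x' _ => by ring
            _ = _ := by
                rw [Finset.sum_add_distrib, Finset.sum_sub_distrib, ← Finset.mul_sum,
                  ← Finset.mul_sum, hd, mul_one]
        simp_rw [e1]
        have e2 : ∑ x, d x * (h x ^ 2 - 2 * h x * (∑ x', d x' * h x') + ∑ x', d x' * h x' ^ 2)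
            = ∑ x, d x * h x ^ 2 - 2 * (∑ x', d x' * h x') * (∑ x', d x' * h x')
              + ∑ x', d x' * h x' ^ 2 := by
          calc _ = ∑ x, (d x * h x ^ 2 - 2 * (∑ x', d x' * h x') * (d x * h x)
                + (∑ x', d x' * h x' ^ 2) * d x) := Finset.sum_congr rfl fun x _ => by ring
            _ = _ := by
                rw [Finset.sum_add_distrib, Finset.sum_sub_distrib, ← Finset.mul_sum,
                  ← Finset.mul_sum, hd, mul_one]
        rw [e2]; ring
      -- Jensen's inequality moves the square inside the average over the other coordinates.
      have h3 : ∑ x, d x * ∑ x', d x' * (h x - h x') ^ 2 ≤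
          avg d fun S => ∑ x, d x * (f S - f (Function.update S 0 x)) ^ 2 := by
        rw [avg_cons]
        refine Finset.sum_le_sum fun x _ => mul_le_mul_of_nonneg_left ?_ (hd0 x)
        rw [avg_sum]
        refine Finset.sum_le_sum fun x' _ => ?_
        rw [avg_mul_left]
        refine mul_le_mul_of_nonneg_left ?_ (hd0 x')
        simp only [Fin.update_cons_zero, hh]
        rw [← avg_sub]
        exact avg_sq_le hd0 hd _
      have h4 : ∑ x, d x * (1 / 2 * ∑ i, avg d fun S : Fin N → X => ∑ x', d x' *
            (f (Fin.cons x S) - f (Fin.cons x (Function.update S i x'))) ^ 2)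
          = 1 / 2 * ∑ i : Fin N, avg d fun S => ∑ x, d x *
            (f S - f (Function.update S i.succ x)) ^ 2 := by
        rw [Finset.mul_sum]
        simp_rw [Finset.mul_sum]
        rw [Finset.sum_comm]
        refine Finset.sum_congr rfl fun i _ => ?_
        rw [avg_cons, Finset.mul_sum]
        refine Finset.sum_congr rfl fun x _ => ?_
        simp only [Fin.cons_update]
        ring
      linarith

theorem efronStein {d : X → ℝ} (hd0 : ∀ x, 0 ≤ d x) (hd : ∑ x, d x = 1) (f : (ι → X) → ℝ) :
    (avg d fun S => f S ^ 2) - avg d f ^ 2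
      ≤ 1 / 2 * ∑ i, avg d fun S => ∑ x, d x * (f S - f (Function.update S i x)) ^ 2 := by
  let φ : ι ≃ Fin (Fintype.card ι) := Fintype.equivFin ι
  have h := efronStein_fin hd0 hd fun S : Fin (Fintype.card ι) → X => f fun i => S (φ i)
  rw [avg_comp_equiv d φ f, avg_comp_equiv d φ fun S => f S ^ 2, ← φ.sum_comp] at h
  refine h.trans (le_of_eq ?_)
  congr 1
  refine Finset.sum_congr rfl fun i _ => ?_
  rw [← avg_comp_equiv d φ]
  congr 1
  funext S
  refine Finset.sum_congr rfl fun x _ => ?_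
  have : (fun j => Function.update S (φ i) x (φ j))
      = Function.update (fun j => S (φ j)) i x := by
    funext j
    by_cases hj : j = i
    · subst hj; simp
    · rw [Function.update_of_ne hj, Function.update_of_ne (φ.injective.ne hj)]
  rw [this]

end Avg

/-! ### Concentration of subsampled output probabilities on the square-root scale. -/

section Subsampling

open scoped BigOperators

theorem expect_update_eq {n s : ℕ} (l : Fin n) (g : (Fin n → Fin s) → ℝ) :
    𝔼 c, 𝔼 I, g (Function.update I l c) = 𝔼 I, g I := by
  rcases Nat.eq_zero_or_pos s with rfl | hs
  · have : IsEmpty (Fin n → Fin 0) := ⟨fun I => (I l).elim0⟩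
    simp [Finset.expect]
  have : Nonempty (Fin s) := ⟨⟨0, hs⟩⟩
  have h : ∑ q : (Fin n → Fin s) × Fin s, g (Function.update q.1 l q.2)
      = ∑ q : (Fin n → Fin s) × Fin s, g q.1 := by
    rw [← (swapCoord l).sum_comp]
    refine Finset.sum_congr rfl fun q _ => ?_
    simp [swapCoord]
  rw [Fintype.sum_prod_type_right, Fintype.sum_prod_type_right] at h
  simp only [Fintype.expect_eq_sum_div_card, Fintype.card_fin]
  rw [← Finset.sum_div, h]
  simp only [Finset.sum_const, Finset.card_univ, Fintype.card_fin, nsmul_eq_mul]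
  have : (s : ℝ) ≠ 0 := by positivity
  field_simp

variable {X : Type*} {Y : Type*} {n s : ℕ}

/-- The average of `a` over all datasets whose `l`-th point is taken from the `l`-th row. -/
noncomputable def subAvg (a : (Fin n → X) → Y → ℝ) (B : Fin n × Fin s → X) (y : Y) : ℝ :=
  𝔼 I : Fin n → Fin s, a (fun l => B (l, I l)) y

/-- The part of `subAvg` in which the `l`-th point is the `c`-th one of its row. -/
noncomputable def subAvgAt (a : (Fin n → X) → Y → ℝ) (l : Fin n) (c : Fin s)
    (B : Fin n × Fin s → X) (y : Y) : ℝ :=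
  𝔼 I : Fin n → Fin s, a (fun l' => B (l', Function.update I l c l')) y

theorem expect_subAvgAt (a : (Fin n → X) → Y → ℝ) (l : Fin n) (B : Fin n × Fin s → X) (y : Y) :
    𝔼 c, subAvgAt a l c B y = subAvg a B y :=
  expect_update_eq l fun I => a (fun l' => B (l', I l')) y

theorem subAvg_nonneg {a : (Fin n → X) → Y → ℝ} (ha : ∀ S y, 0 ≤ a S y)
    (B : Fin n × Fin s → X) (y : Y) : 0 ≤ subAvg a B y :=
  Finset.expect_nonneg fun _ _ => ha _ _

theorem subAvgAt_update_of_ne (a : (Fin n → X) → Y → ℝ) (l : Fin n) {c c' : Fin s}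
    (h : c' ≠ c) (B : Fin n × Fin s → X) (x : X) (y : Y) :
    subAvgAt a l c' (Function.update B (l, c) x) y = subAvgAt a l c' B y := by
  unfold subAvgAt
  refine Finset.expect_congr rfl fun I _ => ?_
  congr 1
  funext l'
  rw [Function.update_of_ne]
  rintro h2
  rw [Prod.mk.injEq] at h2
  obtain ⟨rfl, h2⟩ := h2
  rw [Function.update_self] at h2
  exact h h2

/-- Only the index vectors choosing column `c` in row `l` see the changed point, and they form a
fraction `1 / s` of all index vectors. -/
theorem subAvg_sub_update (a : (Fin n → X) → Y → ℝ) (l : Fin n) (c : Fin s)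
    (B : Fin n × Fin s → X) (x : X) (y : Y) :
    s * (subAvg a B y - subAvg a (Function.update B (l, c) x) y)
      = subAvgAt a l c B y - subAvgAt a l c (Function.update B (l, c) x) y := by
  have hs : (s : ℝ) ≠ 0 := by have := c.pos; positivity
  rw [← expect_subAvgAt a l, ← expect_subAvgAt a l, Fintype.expect_eq_sum_div_card,
    Fintype.expect_eq_sum_div_card, Fintype.card_fin, ← sub_div, mul_div_cancel₀ _ hs,
    ← Finset.sum_sub_distrib]
  rw [Finset.sum_eq_single c]
  · intro c' _ hc'
    rw [subAvgAt_update_of_ne a l hc', sub_self]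
  · exact fun h => absurd (Finset.mem_univ c) h

/-- Since `√u + √v` squared is at least `u + v`, the left side times `w = u + v` is at most `|u - v|
^ 2`. One factor is bounded by `(τ w + g) / s` from closeness. The other factor is expanded in the
same way, but against its additive part `g / s` the trivial bound `|u - v| ≤ w` is used, so that
division by `w` leaves an error linear in `g`. -/
theorem sq_sqrt_sub_sqrt_le {u v A A' s e E₁ E₂ E₃ : ℝ} (hu : 0 ≤ u) (hv : 0 ≤ v)
    (hs : 0 < s) (he : 1 ≤ e) (hE₁ : 0 ≤ E₁) (hE₂ : 0 ≤ E₂)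
    (hE₃ : 0 ≤ E₃) (huv : s * (u - v) = A - A')
    (h₁ : A ≤ e * A' + E₁) (h₂ : A' ≤ e * A + E₂) (h₃ : A ≤ e * u + E₃) :
    (√u - √v) ^ 2 ≤ ((e - 1) * e) ^ 2 / s ^ 2 * (u + v)
      + ((e - 1) * e / s ^ 2 + 1 / s) * ((e - 1) * E₃ + E₁ + E₂) := by
  set τ := (e - 1) * e with hτ
  set g := (e - 1) * E₃ + E₁ + E₂ with hg
  set w := u + v with hw
  have he0 : 0 ≤ e - 1 := by linarith
  have hτ0 : 0 ≤ τ := by positivity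
  have hg0 : 0 ≤ g := by positivity
  have hw0 : 0 ≤ w := by positivity
  set h := |u - v| with hh
  have hh0 : 0 ≤ h := abs_nonneg _
  have hsh : s * h = |A - A'| := by rw [← huv, abs_mul, abs_of_pos hs]
  have hle1 : s * h ≤ τ * w + g := by
    have h3' : (e - 1) * A ≤ τ * w + (e - 1) * E₃ := by
      have h4 : (e - 1) * A ≤ (e - 1) * (e * u + E₃) := by gcongr
      have h5 : 0 ≤ τ * v := by positivity
      rw [hτ, hw]; rw [hτ] at h5; nlinarith
    rw [hsh, abs_le]
    rcases le_total A A' with h | h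
    · constructor <;> nlinarith
    · have h6 : (e - 1) * A' ≤ (e - 1) * A := by gcongr
      constructor <;> nlinarith
  have hle2 : h ≤ w := by
    rw [hh, abs_le]; constructor <;> linarith
  have hkey : (√u - √v) ^ 2 * w ≤ h ^ 2 := by
    have h1 : h ^ 2 = (√u - √v) ^ 2 * (√u + √v) ^ 2 := by
      rw [hh, sq_abs, ← mul_pow]
      have : (√u - √v) * (√u + √v) = u - v := by
        nlinarith [Real.sq_sqrt hu, Real.sq_sqrt hv]
      rw [this]
    rw [h1]
    gcongr
    nlinarith [Real.sq_sqrt hu, Real.sq_sqrt hv, Real.sqrt_nonneg u, Real.sqrt_nonneg v,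
      mul_nonneg (Real.sqrt_nonneg u) (Real.sqrt_nonneg v)]
  rcases hw0.eq_or_lt with hw0' | hwpos
  · have hu0 : u = 0 := by linarith
    have hv0 : v = 0 := by linarith
    rw [hu0, hv0]
    simp only [sub_self, ne_eq, OfNat.ofNat_ne_zero, not_false_eq_true, zero_pow]
    positivity
  · refine le_of_mul_le_mul_right (hkey.trans ?_) hwpos
    have h1 : h ≤ (τ * w + g) / s := by rw [le_div_iff₀ hs]; linarith
    calc h ^ 2 = h * h := by ring
      _ ≤ h * ((τ * w + g) / s) := by gcongr
      _ = h * (τ * w / s) + h * (g / s) := by ring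
      _ ≤ (τ * w + g) / s * (τ * w / s) + w * (g / s) := by gcongr
      _ = _ := by field_simp; ring

/-- `a` satisfies `(log e, δ)`-differential privacy on finite sets of outputs. -/
def FinDP (a : (Fin n → X) → Y → ℝ) (e δ : ℝ) : Prop :=
  ∀ (S S' : Fin n → X) (i : Fin n), (∀ j, j ≠ i → S j = S' j) →
    ∀ F : Finset Y, ∑ y ∈ F, max 0 (a S y - e * a S' y) ≤ δ

theorem sum_expect_le {σ : Type*} [Fintype σ] [Nonempty σ] {F : Finset Y} {g : σ → Y → ℝ} {δ : ℝ}
    (h : ∀ i, ∑ y ∈ F, g i y ≤ δ) : ∑ y ∈ F, 𝔼 i, g i y ≤ δ := by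
  rw [← Finset.expect_sum_comm]
  calc 𝔼 i, ∑ y ∈ F, g i y ≤ 𝔼 _i : σ, δ := Finset.expect_le_expect fun i _ => h i
    _ = δ := Fintype.expect_const δ

theorem expect_le_mul_add {σ : Type*} [Fintype σ] {f g : σ → ℝ} (e : ℝ) :
    𝔼 i, f i ≤ e * 𝔼 i, g i + 𝔼 i, max 0 (f i - e * g i) := by
  rw [Finset.mul_expect, ← Finset.expect_add_distrib]
  refine Finset.expect_le_expect fun i _ => ?_
  linarith [le_max_right 0 (f i - e * g i)]

/-- A squared Hellinger bound between the subsampled outputs of neighbouring blocks. The errors `E₁`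
and `E₂` compare the two blocks along the same index vector; `E₃` compares column `c` with the other
columns of row `l`, which relates the affected part to the full average. Both are single-coordinate
changes of the input of `M`. -/
theorem hellinger_subAvg_le {a : (Fin n → X) → Y → ℝ} {e δ : ℝ}
    (ha : ∀ S y, 0 ≤ a S y) (ha1 : ∀ S (F : Finset Y), ∑ y ∈ F, a S y ≤ 1) (he : 1 ≤ e)
    (hdp : FinDP a e δ) (l : Fin n) (c : Fin s) (B : Fin n × Fin s → X) (x : X) (F : Finset Y) :
    ∑ y ∈ F, (√(subAvg a B y) - √(subAvg a (Function.update B (l, c) x) y)) ^ 2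
      ≤ ((e - 1) * e) ^ 2 / s ^ 2 * 2
        + ((e - 1) * e / s ^ 2 + 1 / s) * ((e + 1) * δ) := by
  have hs : (0 : ℝ) < s := by have := c.pos; positivity
  have : Nonempty (Fin s) := ⟨c⟩
  set B' := Function.update B (l, c) x with hB'
  let P : (Fin n × Fin s → X) → Fin s → (Fin n → Fin s) → Fin n → X :=
    fun B c I l' => B (l', Function.update I l c l')
  let E₁ : Y → ℝ := fun y => 𝔼 I, max 0 (a (P B c I) y - e * a (P B' c I) y)
  let E₂ : Y → ℝ := fun y => 𝔼 I, max 0 (a (P B' c I) y - e * a (P B c I) y)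
  let E₃ : Y → ℝ := fun y => 𝔼 c', 𝔼 I, max 0 (a (P B c I) y - e * a (P B c' I) y)
  have hBB' : ∀ I, ∀ j, j ≠ l → P B c I j = P B' c I j := by
    intro I j hj
    simp only [P, hB']
    rw [Function.update_of_ne (f := B)]
    simp [hj]
  have hcc : ∀ c' I, ∀ j, j ≠ l → P B c I j = P B c' I j := by
    intro c' I j hj
    simp only [P, Function.update_of_ne hj]
  have hE₁ : ∑ y ∈ F, E₁ y ≤ δ := sum_expect_le fun I => hdp _ _ l (hBB' I) F
  have hE₂ : ∑ y ∈ F, E₂ y ≤ δ :=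
    sum_expect_le fun I => hdp _ _ l (fun j hj => (hBB' I j hj).symm) F
  have hE₃ : ∑ y ∈ F, E₃ y ≤ δ :=
    sum_expect_le fun c' => sum_expect_le fun I => hdp _ _ l (hcc c' I) F
  have hmax : ∀ r : ℝ, 0 ≤ max 0 r := fun r => le_max_left _ _
  have hpt : ∀ y ∈ F, (√(subAvg a B y) - √(subAvg a B' y)) ^ 2
      ≤ ((e - 1) * e) ^ 2 / s ^ 2 * (subAvg a B y + subAvg a B' y)
      + ((e - 1) * e / s ^ 2 + 1 / s) * ((e - 1) * E₃ y + E₁ y + E₂ y) := by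
    intro y _
    refine sq_sqrt_sub_sqrt_le (A := subAvgAt a l c B y) (A' := subAvgAt a l c B' y)
      (subAvg_nonneg ha _ _) (subAvg_nonneg ha _ _) hs he (Finset.expect_nonneg fun _ _ => hmax _)
      (Finset.expect_nonneg fun _ _ => hmax _)
      (Finset.expect_nonneg fun _ _ => Finset.expect_nonneg fun _ _ => hmax _)
      (subAvg_sub_update a l c B x y)
      (expect_le_mul_add e) (expect_le_mul_add e) ?_
    rw [← expect_subAvgAt a l, Finset.mul_expect, ← Finset.expect_add_distrib]
    calc subAvgAt a l c B y = 𝔼 _c' : Fin s, subAvgAt a l c B y := (Fintype.expect_const _).symm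
      _ ≤ _ := Finset.expect_le_expect fun c' _ => expect_le_mul_add e
  have hsum : ∀ B : Fin n × Fin s → X, ∑ y ∈ F, subAvg a B y ≤ 1 := fun B =>
    sum_expect_le fun I => ha1 _ F
  refine (Finset.sum_le_sum hpt).trans ?_
  rw [Finset.sum_add_distrib, ← Finset.mul_sum, ← Finset.mul_sum, Finset.sum_add_distrib,
    Finset.sum_add_distrib, Finset.sum_add_distrib, ← Finset.mul_sum]
  have he0 : 0 ≤ e - 1 := by linarith
  gcongr
  · linarith [hsum B, hsum B']
  · have : (e - 1) * ∑ y ∈ F, E₃ y ≤ (e - 1) * δ := by gcongr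
    linarith

variable [Fintype X]

theorem avg_subAvg {d : X → ℝ} (hd : ∑ x, d x = 1) (hs : 0 < s) (a : (Fin n → X) → Y → ℝ)
    (y : Y) : (avg d fun B : Fin n × Fin s → X => subAvg a B y) = avg d fun S => a S y := by
  have : Nonempty (Fin s) := ⟨⟨0, hs⟩⟩
  simp only [subAvg, Fintype.expect_eq_sum_div_card, div_eq_inv_mul]
  rw [avg_mul_left, avg_sum]
  have h : ∀ I : Fin n → Fin s, (avg d fun B : Fin n × Fin s → X => a (fun l => B (l, I l)) y)
      = avg d fun S => a S y := fun I =>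
    avg_comp_injective hd (φ := fun l => (l, I l)) (fun l l' h => (Prod.mk.inj h).1)
      fun S => a S y
  simp only [h, Finset.sum_const, Finset.card_univ, nsmul_eq_mul]
  have : (Fintype.card (Fin n → Fin s) : ℝ) ≠ 0 := by
    exact_mod_cast Fintype.card_ne_zero
  field_simp

/-- The total variance of the square roots of the averaged output probabilities. -/
theorem sum_variance_sqrt_le {d : X → ℝ} (hd0 : ∀ x, 0 ≤ d x) (hd : ∑ x, d x = 1)
    {a : (Fin n → X) → Y → ℝ} {e δ : ℝ}
    (ha : ∀ S y, 0 ≤ a S y) (ha1 : ∀ S (F : Finset Y), ∑ y ∈ F, a S y ≤ 1) (he : 1 ≤ e)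
    (hdp : FinDP a e δ) (F : Finset Y) :
    ∑ y ∈ F, ((avg d fun B : Fin n × Fin s → X => √(subAvg a B y) ^ 2)
        - (avg d fun B : Fin n × Fin s → X => √(subAvg a B y)) ^ 2)
      ≤ 1 / 2 * (n * s * (((e - 1) * e) ^ 2 / s ^ 2 * 2
        + ((e - 1) * e / s ^ 2 + 1 / s) * ((e + 1) * δ))) := by
  set κ := ((e - 1) * e) ^ 2 / (s : ℝ) ^ 2 * 2
        + ((e - 1) * e / s ^ 2 + 1 / s) * ((e + 1) * δ)
  calc _ ≤ ∑ y ∈ F, 1 / 2 * ∑ i, avg d fun B : Fin n × Fin s → X => ∑ x, d x *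
          (√(subAvg a B y) - √(subAvg a (Function.update B i x) y)) ^ 2 :=
        Finset.sum_le_sum fun y _ => efronStein hd0 hd fun B => √(subAvg a B y)
    _ = 1 / 2 * ∑ i, avg d fun B : Fin n × Fin s → X => ∑ x, d x * ∑ y ∈ F,
          (√(subAvg a B y) - √(subAvg a (Function.update B i x) y)) ^ 2 := by
        rw [← Finset.mul_sum, Finset.sum_comm]
        congr 1
        refine Finset.sum_congr rfl fun i _ => ?_
        rw [← avg_sum]
        congr 1
        funext B
        rw [Finset.sum_comm]
        exact Finset.sum_congr rfl fun x _ => (Finset.mul_sum _ _ _).symm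
    _ ≤ 1 / 2 * ∑ _i : Fin n × Fin s, κ := by
        gcongr with i
        calc _ ≤ avg d fun _ : Fin n × Fin s → X => κ := by
              refine avg_mono hd0 fun B => ?_
              calc _ ≤ ∑ x, d x * κ := Finset.sum_le_sum fun x _ =>
                    mul_le_mul_of_nonneg_left
                      (hellinger_subAvg_le ha ha1 he hdp i.1 i.2 B x F) (hd0 x)
                _ = κ := by rw [← Finset.sum_mul, hd, one_mul]
          _ = κ := avg_const hd κ
    _ = _ := by simp

/-- The factorization `(μ - r) (μ + r) ≥ 3/20 * p` together with `(μ + r) ^ 2 ≤ 18/5 * p` forces a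
gap of order `√p`; the constant `160` is the quotient of `18/5` by `(3/20) ^ 2`. -/
theorem le_sq_sub_of_sq_lt {p μ r : ℝ} (hp : 0 ≤ p)
    (h1 : 19 / 20 * p ≤ μ ^ 2) (h1' : μ ^ 2 ≤ p) (h2 : r ^ 2 < 4 / 5 * p) :
    p ≤ 160 * (r - μ) ^ 2 := by
  have h3 : (μ + r) ^ 2 ≤ 18 / 5 * p := by nlinarith [sq_nonneg (μ - r)]
  have h4 : 3 / 20 * p ≤ (μ - r) * (μ + r) := by nlinarith
  have h5 : (3 / 20 * p) ^ 2 ≤ (μ - r) ^ 2 * (18 / 5 * p) := by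
    calc (3 / 20 * p) ^ 2 ≤ ((μ - r) * (μ + r)) ^ 2 := by gcongr
      _ = (μ - r) ^ 2 * (μ + r) ^ 2 := by ring
      _ ≤ _ := by gcongr
  have hp' : 0 < p := by nlinarith [sq_nonneg r]
  have h6 : p * (9 / 400 * p) ≤ p * (18 / 5 * (μ - r) ^ 2) := by nlinarith
  have h7 := le_of_mul_le_mul_left h6 hp'
  nlinarith

open Classical in
/-- Chebyshev's inequality on the square-root scale. -/
theorem mul_avg_lt_le {ι : Type*} [Fintype ι] [DecidableEq ι] {d : X → ℝ} (hd0 : ∀ x, 0 ≤ d x)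
    (hd : ∑ x, d x = 1) {b : (ι → X) → ℝ} (hb : ∀ B, 0 ≤ b B) :
    avg d b * (avg d fun B => if b B < 4 / 5 * avg d b then 1 else 0)
      ≤ 160 * ((avg d fun B => √(b B) ^ 2) - (avg d fun B => √(b B)) ^ 2) := by
  set p := avg d b with hp
  set μ := avg d fun B => √(b B) with hμ
  have hp0 : 0 ≤ p := avg_nonneg hd0 hb
  have hμ0 : 0 ≤ μ := avg_nonneg hd0 fun _ => Real.sqrt_nonneg _
  have hsq : (avg d fun B => √(b B) ^ 2) = p := by
    rw [hp]; congr 1; funext B; exact Real.sq_sqrt (hb B)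
  have hle : μ ^ 2 ≤ p := by rw [← hsq]; exact avg_sq_le hd0 hd _
  rw [hsq]
  rcases lt_or_ge (μ ^ 2) (19 / 20 * p) with h | h
  -- Here the variance `p - μ ^ 2` already exceeds `p / 20`, so bounding the probability by one is
  -- enough.
  · have h1 : (avg d fun B => if b B < 4 / 5 * p then (1 : ℝ) else 0) ≤ 1 := by
      refine le_trans (avg_mono hd0 fun B => ?_) (avg_const (ι := ι) hd 1).le
      split_ifs <;> norm_num
    nlinarith
  · rw [← avg_mul_left]
    calc _ ≤ avg d fun B => 160 * (√(b B) - μ) ^ 2 := by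
          refine avg_mono hd0 fun B => ?_
          split_ifs with hB
          · rw [mul_one]
            refine le_sq_sub_of_sq_lt hp0 h hle ?_
            rwa [Real.sq_sqrt (hb B)]
          · rw [mul_zero]; positivity
      _ = _ := by
          have h2 : (fun B => 160 * (√(b B) - μ) ^ 2)
              = fun B => 160 * (√(b B) ^ 2 - 2 * μ * √(b B) + μ ^ 2) := by
            funext B; ring
          rw [h2, avg_mul_left, avg_add, avg_sub, avg_mul_left, avg_const hd, hsq]
          ring

open Classical in
theorem sum_mul_avg_lt_le {d : X → ℝ} (hd0 : ∀ x, 0 ≤ d x) (hd : ∑ x, d x = 1) (hs : 0 < s)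
    {a : (Fin n → X) → Y → ℝ} {e δ : ℝ}
    (ha : ∀ S y, 0 ≤ a S y) (ha1 : ∀ S (F : Finset Y), ∑ y ∈ F, a S y ≤ 1) (he : 1 ≤ e)
    (hdp : FinDP a e δ) (F : Finset Y) :
    ∑ y ∈ F, (avg d fun S => a S y) * (avg d fun B : Fin n × Fin s → X =>
        if subAvg a B y < 4 / 5 * avg d fun S => a S y then 1 else 0)
      ≤ 80 * (n * s * (((e - 1) * e) ^ 2 / s ^ 2 * 2
        + ((e - 1) * e / s ^ 2 + 1 / s) * ((e + 1) * δ))) := by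
  calc _ ≤ ∑ y ∈ F, 160 * ((avg d fun B : Fin n × Fin s → X => √(subAvg a B y) ^ 2)
        - (avg d fun B : Fin n × Fin s → X => √(subAvg a B y)) ^ 2) := by
        refine Finset.sum_le_sum fun y _ => ?_
        have h := mul_avg_lt_le hd0 hd (b := fun B : Fin n × Fin s → X => subAvg a B y)
          fun B => subAvg_nonneg ha B y
        rwa [avg_subAvg hd hs] at h
    _ ≤ _ := by
        rw [← Finset.mul_sum]
        have := sum_variance_sqrt_le (s := s) hd0 hd ha ha1 he hdp F
        linarith

end Subsampling

/-! ### Stable aggregation of output distributions by a soft quantile. -/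

section Aggregation

variable {r : ℕ}

/-- The largest level `c`, weighted by a function of the number of entries of size at least `c`. -/
noncomputable def levelAgg (w : ℕ → ℝ≥0∞) (b : Fin r → ℝ≥0∞) : ℝ≥0∞ :=
  ⨆ c : ℝ≥0∞, c * w (Finset.univ.filter fun j => c ≤ b j).card

theorem le_levelAgg (w : ℕ → ℝ≥0∞) (b : Fin r → ℝ≥0∞) (c : ℝ≥0∞) :
    c * w (Finset.univ.filter fun j => c ≤ b j).card ≤ levelAgg w b :=
  le_iSup (fun c : ℝ≥0∞ => c * w (Finset.univ.filter fun j => c ≤ b j).card) c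

/-- If `t` entries are at least `c`, then `c t` is at most their sum. The hypothesis at `t = 0`
makes `w` vanish there, without which arbitrarily large levels would make the supremum infinite. -/
theorem levelAgg_le_sum {w : ℕ → ℝ≥0∞} {κ : ℝ≥0∞} (hκ : ∀ t : ℕ, w t ≤ κ * t)
    (b : Fin r → ℝ≥0∞) : levelAgg w b ≤ κ * ∑ j, b j := by
  refine iSup_le fun c => ?_
  calc c * w (Finset.univ.filter fun j => c ≤ b j).card
      ≤ c * (κ * (Finset.univ.filter fun j => c ≤ b j).card) := by gcongr; exact hκ _
    _ = κ * ∑ _j ∈ Finset.univ.filter fun j => c ≤ b j, c := by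
        rw [Finset.sum_const, nsmul_eq_mul]; ring
    _ ≤ κ * ∑ j ∈ Finset.univ.filter fun j => c ≤ b j, b j := by
        gcongr with j hj
        exact (Finset.mem_filter.1 hj).2
    _ ≤ κ * ∑ j, b j := by
        gcongr
        exact Finset.subset_univ _

/-- Changing one entry changes each level count by at most one, which costs a factor `e` as long as
the other list still reaches the level. If it does not, only `j₀` can reach the level, so `c` is at
most `b j₀` and the weight is at most `w 1`. -/
theorem levelAgg_le_of_eq_off {w : ℕ → ℝ≥0∞} {e : ℝ≥0∞} (hw0 : w 0 = 0) (hw : Monotone w)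
    (hstep : ∀ t, w (t + 2) ≤ e * w (t + 1)) {b b' : Fin r → ℝ≥0∞} {j₀ : Fin r}
    (hb : ∀ j, j ≠ j₀ → b j = b' j) :
    levelAgg w b ≤ e * levelAgg w b' + w 1 * b j₀ := by
  refine iSup_le fun c => ?_
  set F := Finset.univ.filter fun j => c ≤ b j with hF
  set F' := Finset.univ.filter fun j => c ≤ b' j with hF'
  have hsub : F ⊆ insert j₀ F' := by
    intro j hj
    rcases eq_or_ne j j₀ with rfl | hne
    · exact Finset.mem_insert_self _ _
    · refine Finset.mem_insert_of_mem ?_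
      rw [hF', Finset.mem_filter, ← hb j hne]
      exact ⟨Finset.mem_univ _, (Finset.mem_filter.1 hj).2⟩
  have hcard : F.card ≤ F'.card + 1 := (Finset.card_le_card hsub).trans (Finset.card_insert_le _ _)
  rcases Nat.eq_zero_or_pos F'.card with h0 | hpos
  · refine le_trans ?_ le_add_self
    rcases Nat.eq_zero_or_pos F.card with h1 | h1
    · rw [h1, hw0, mul_zero]; exact zero_le
    · obtain ⟨j, hj⟩ := Finset.card_pos.1 h1
      have hj0 : j = j₀ := by
        have := hsub hj
        rw [Finset.card_eq_zero.1 h0] at this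
        simpa using this
      have hc : c ≤ b j₀ := by rw [← hj0]; exact (Finset.mem_filter.1 hj).2
      rw [mul_comm]
      gcongr
      exact hw (by omega)
  · refine le_trans ?_ le_self_add
    obtain ⟨t, ht⟩ : ∃ t, F'.card = t + 1 := ⟨F'.card - 1, by omega⟩
    calc c * w F.card ≤ c * (e * w F'.card) := by
          gcongr
          rw [ht]
          exact (hw (by omega)).trans (hstep t)
      _ = e * (c * w F'.card) := by ring
      _ ≤ _ := by gcongr; exact le_levelAgg w b' c

open Classical in
/-- Pointwise aggregation of output probabilities, with extra weight `η` on `y₀`. -/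
noncomputable def aggWeight {Y : Type*} (w : ℕ → ℝ≥0∞) (η : ℝ≥0∞) (y₀ : Y)
    (q : Fin r → PMF Y) (y : Y) : ℝ≥0∞ :=
  levelAgg w (fun j => q j y) + if y = y₀ then η else 0

variable {Y : Type*} {w : ℕ → ℝ≥0∞} {κ η : ℝ≥0∞} {y₀ : Y}

theorem tsum_aggWeight_le (hκ : ∀ t : ℕ, w t ≤ κ * t) (q : Fin r → PMF Y) (T : Set Y) :
    ∑' y, T.indicator (aggWeight w η y₀ q) y
      ≤ κ * ∑ j, (q j).toOuterMeasure T + η := by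
  classical
  simp_rw [PMF.toOuterMeasure_apply]
  have h1 : η = ∑' y, if y = y₀ then η else 0 := (tsum_ite_eq y₀ fun _ => η).symm
  conv_rhs => rw [h1]
  rw [← Summable.tsum_finsetSum fun _ _ => ENNReal.summable, ← ENNReal.tsum_mul_left,
    ← ENNReal.tsum_add]
  refine ENNReal.tsum_le_tsum fun y => ?_
  by_cases hy : y ∈ T
  · simp only [Set.indicator_of_mem hy, aggWeight]
    gcongr
    exact levelAgg_le_sum hκ _
  · rw [Set.indicator_of_notMem hy]; exact zero_le

theorem tsum_aggWeight_ne_top (hκ : ∀ t : ℕ, w t ≤ κ * t) (hκtop : κ ≠ ∞) (hη : η ≠ ∞)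
    (q : Fin r → PMF Y) : ∑' y, aggWeight w η y₀ q y ≠ ∞ := by
  have h := tsum_aggWeight_le (η := η) (y₀ := y₀) hκ q Set.univ
  rw [Set.indicator_univ] at h
  refine ne_top_of_le_ne_top (ENNReal.add_ne_top.2 ⟨ENNReal.mul_ne_top hκtop ?_, hη⟩) h
  exact ENNReal.sum_ne_top.2 fun j _ => toOuterMeasure_ne_top _ _

theorem le_tsum_aggWeight (w : ℕ → ℝ≥0∞) (η : ℝ≥0∞) (y₀ : Y) (q : Fin r → PMF Y) :
    η ≤ ∑' y, aggWeight w η y₀ q y := by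
  classical
  calc η ≤ aggWeight w η y₀ q y₀ := by simp [aggWeight]
    _ ≤ _ := ENNReal.le_tsum _

/-- Sample an output with probability proportional to its aggregated weight. -/
noncomputable def aggregate (w : ℕ → ℝ≥0∞) (η : ℝ≥0∞) (y₀ : Y) (q : Fin r → PMF Y)
    (hη : η ≠ 0) (htop : ∑' y, aggWeight w η y₀ q y ≠ ∞) : PMF Y :=
  PMF.normalize (aggWeight w η y₀ q)
    (ne_bot_of_le_ne_bot hη (le_tsum_aggWeight w η y₀ q)) htop

theorem prob_aggregate (hη : η ≠ 0) (q : Fin r → PMF Y)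
    (htop : ∑' y, aggWeight w η y₀ q y ≠ ∞) (T : Set Y) :
    prob (aggregate w η y₀ q hη htop) T
      = (∑' y, T.indicator (aggWeight w η y₀ q) y).toReal
          / (∑' y, aggWeight w η y₀ q y).toReal := by
  rw [prob, PMF.toOuterMeasure_apply, div_eq_mul_inv, ← ENNReal.toReal_inv, ← ENNReal.toReal_mul,
    ← ENNReal.tsum_mul_right]
  congr 1
  refine tsum_congr fun y => ?_
  by_cases hy : y ∈ T
  · simp only [Set.indicator_of_mem hy, aggregate, PMF.normalize_apply]
  · simp only [Set.indicator_of_notMem hy, zero_mul]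

/-- The numerator and the normalizer each cost a factor `e`, hence the square. The floor `η` on the
normalizers controls the additive errors after division. -/
theorem div_le_of_close {a a' Z Z' e ρ η : ℝ} (he : 0 ≤ e) (hρ : 0 ≤ ρ) (hη : 0 < η)
    (haZ' : 0 ≤ a' ∧ a' ≤ Z') (hZ : η ≤ Z) (hZ' : η ≤ Z') (h : a ≤ e * a' + ρ)
    (h' : Z' ≤ e * Z + ρ) : a / Z ≤ e ^ 2 * (a' / Z') + (e + 1) * ρ / η := by
  have hZpos : 0 < Z := hη.trans_le hZ
  have hZ'pos : 0 < Z' := hη.trans_le hZ'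
  have hx1 : a' / Z' ≤ 1 := (div_le_one hZ'pos).2 haZ'.2
  have hx0 : 0 ≤ a' / Z' := div_nonneg haZ'.1 hZ'pos.le
  have h1 : ρ / Z ≤ ρ / η := by gcongr
  have h2 : a' / Z ≤ a' / Z' * e + ρ / η := by
    calc a' / Z = a' / Z' * (Z' / Z) := by field_simp
      _ ≤ a' / Z' * ((e * Z + ρ) / Z) := by gcongr
      _ = a' / Z' * e + a' / Z' * (ρ / Z) := by field_simp
      _ ≤ a' / Z' * e + 1 * (ρ / η) := by gcongr
      _ = _ := by ring
  calc a / Z ≤ (e * a' + ρ) / Z := by gcongr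
    _ = e * (a' / Z) + ρ / Z := by ring
    _ ≤ e * (a' / Z' * e + ρ / η) + ρ / η := by gcongr
    _ = _ := by ring

theorem toReal_le_of_le_mul_add {a b : ℝ≥0∞} {e ρ : ℝ} (he : 0 ≤ e) (hρ : 0 ≤ ρ) (hb : b ≠ ∞)
    (h : a ≤ ENNReal.ofReal e * b + ENNReal.ofReal ρ) : a.toReal ≤ e * b.toReal + ρ := by
  have h1 := ENNReal.toReal_mono (ENNReal.add_ne_top.2
    ⟨ENNReal.mul_ne_top ENNReal.ofReal_ne_top hb, ENNReal.ofReal_ne_top⟩) h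
  rwa [ENNReal.toReal_add (ENNReal.mul_ne_top ENNReal.ofReal_ne_top hb) ENNReal.ofReal_ne_top,
    ENNReal.toReal_mul, ENNReal.toReal_ofReal he, ENNReal.toReal_ofReal hρ] at h1

theorem tsum_aggWeight_le_of_eq_off {e : ℝ} (he : 1 ≤ e) (hw0 : w 0 = 0)
    (hw : Monotone w) (hstep : ∀ t, w (t + 2) ≤ ENNReal.ofReal e * w (t + 1))
    {q q' : Fin r → PMF Y} {j₀ : Fin r} (hq : ∀ j, j ≠ j₀ → q j = q' j) (T : Set Y) :
    ∑' y, T.indicator (aggWeight w η y₀ q) y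
      ≤ ENNReal.ofReal e * ∑' y, T.indicator (aggWeight w η y₀ q') y + w 1 := by
  classical
  have h1 : w 1 = ∑' y, w 1 * q j₀ y := by rw [ENNReal.tsum_mul_left, (q j₀).tsum_coe, mul_one]
  conv_rhs => rw [h1]
  rw [← ENNReal.tsum_mul_left, ← ENNReal.tsum_add]
  refine ENNReal.tsum_le_tsum fun y => ?_
  by_cases hy : y ∈ T
  · simp only [Set.indicator_of_mem hy, aggWeight]
    have h2 := levelAgg_le_of_eq_off hw0 hw hstep (b := fun j => q j y) (b' := fun j => q' j y)
      (j₀ := j₀) fun j hj => by rw [hq j hj]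
    have h3 : (if y = y₀ then η else 0) ≤ ENNReal.ofReal e * (if y = y₀ then η else 0) :=
      le_mul_of_one_le_left' (by simpa using he)
    rw [mul_add, add_right_comm]
    exact add_le_add h2 h3
  · rw [Set.indicator_of_notMem hy]; exact zero_le

/-- Changing one of the aggregated distributions has little effect on the result. -/
theorem prob_aggregate_le {e ρ η : ℝ} (he : 1 ≤ e) (hρ : 0 ≤ ρ) (hη : 0 < η)
    (hw0 : w 0 = 0) (hw : Monotone w)
    (hstep : ∀ t, w (t + 2) ≤ ENNReal.ofReal e * w (t + 1)) (hw1 : w 1 ≤ ENNReal.ofReal ρ)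
    {q q' : Fin r → PMF Y} {j₀ : Fin r} (hq : ∀ j, j ≠ j₀ → q j = q' j)
    (hη0 : ENNReal.ofReal η ≠ 0)
    (htop : ∑' y, aggWeight w (ENNReal.ofReal η) y₀ q y ≠ ∞)
    (htop' : ∑' y, aggWeight w (ENNReal.ofReal η) y₀ q' y ≠ ∞) (T : Set Y) :
    prob (aggregate w (ENNReal.ofReal η) y₀ q hη0 htop) T
      ≤ e ^ 2 * prob (aggregate w (ENNReal.ofReal η) y₀ q' hη0 htop') T + (e + 1) * ρ / η := by
  have hle : ∀ q : Fin r → PMF Y, ∑' y, T.indicator (aggWeight w (ENNReal.ofReal η) y₀ q) y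
      ≤ ∑' y, aggWeight w (ENNReal.ofReal η) y₀ q y := fun q =>
    ENNReal.tsum_le_tsum fun y => Set.indicator_le_self' (fun _ _ => zero_le) y
  have hZ : ∀ q : Fin r → PMF Y, ∑' y, aggWeight w (ENNReal.ofReal η) y₀ q y ≠ ∞ →
      η ≤ (∑' y, aggWeight w (ENNReal.ofReal η) y₀ q y).toReal := fun q hq =>
    (ENNReal.ofReal_le_iff_le_toReal hq).1 (le_tsum_aggWeight _ _ _ q)
  rw [prob_aggregate, prob_aggregate]
  refine div_le_of_close (by linarith) hρ hη
    ⟨ENNReal.toReal_nonneg, ENNReal.toReal_mono htop' (hle q')⟩ (hZ q htop) (hZ q' htop')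
    (toReal_le_of_le_mul_add (by linarith) hρ (ne_top_of_le_ne_top htop' (hle q')) ?_)
    (toReal_le_of_le_mul_add (by linarith) hρ htop ?_)
  · exact (tsum_aggWeight_le_of_eq_off he hw0 hw hstep hq T).trans (by gcongr)
  · have h := tsum_aggWeight_le_of_eq_off (η := ENNReal.ofReal η) (y₀ := y₀) he hw0 hw hstep
      (q := q') (q' := q) (j₀ := j₀) (fun j hj => (hq j hj).symm) Set.univ
    rw [Set.indicator_univ, Set.indicator_univ] at h
    exact h.trans (by gcongr)

/-- The weights `exp (-ε (t₀ - t)₊)`, with `0` at `0`. -/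
noncomputable def stepWeight (ε : ℝ) (t₀ t : ℕ) : ℝ≥0∞ :=
  if t = 0 then 0 else ENNReal.ofReal (Real.exp (-(ε * ((t₀ - t : ℕ) : ℝ))))

theorem stepWeight_zero (ε : ℝ) (t₀ : ℕ) : stepWeight ε t₀ 0 = 0 := by simp [stepWeight]

theorem stepWeight_one (ε : ℝ) (t₀ : ℕ) :
    stepWeight ε t₀ 1 = ENNReal.ofReal (Real.exp (-(ε * ((t₀ - 1 : ℕ) : ℝ)))) := by
  simp [stepWeight]

theorem stepWeight_of_le {ε : ℝ} {t₀ t : ℕ} (h0 : 0 < t) (h : t₀ ≤ t) :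
    stepWeight ε t₀ t = 1 := by
  simp [stepWeight, h0.ne', Nat.sub_eq_zero_of_le h]

theorem monotone_stepWeight {ε : ℝ} (hε : 0 ≤ ε) (t₀ : ℕ) : Monotone (stepWeight ε t₀) := by
  intro s t hst
  unfold stepWeight
  rcases Nat.eq_zero_or_pos s with rfl | hs
  · simp
  · rw [if_neg hs.ne', if_neg (hs.trans_le hst).ne']
    refine ENNReal.ofReal_le_ofReal (Real.exp_le_exp.2 (neg_le_neg ?_))
    gcongr

theorem stepWeight_step {ε : ℝ} (hε : 0 ≤ ε) (t₀ t : ℕ) :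
    stepWeight ε t₀ (t + 2) ≤ ENNReal.ofReal (Real.exp ε) * stepWeight ε t₀ (t + 1) := by
  unfold stepWeight
  rw [if_neg (by omega), if_neg (by omega), ← ENNReal.ofReal_mul (Real.exp_pos _).le,
    ← Real.exp_add]
  refine ENNReal.ofReal_le_ofReal (Real.exp_le_exp.2 ?_)
  have h : ((t₀ - (t + 1) : ℕ) : ℝ) ≤ ((t₀ - (t + 2) : ℕ) : ℝ) + 1 := by
    exact_mod_cast (by omega : t₀ - (t + 1) ≤ t₀ - (t + 2) + 1)
  nlinarith

/-- For `t` at least half of `t₀` the right side is at least one; below that the exponential decay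
makes the weight at most `2 / t₀`. -/
theorem stepWeight_le_mul {ε : ℝ} {t₀ : ℕ} (hε : 0 ≤ ε) (ht₀ : 0 < t₀)
    (h : Real.exp (-(ε * (t₀ / 2))) ≤ 2 / t₀) (t : ℕ) :
    stepWeight ε t₀ t ≤ ENNReal.ofReal (2 / t₀) * t := by
  unfold stepWeight
  rcases Nat.eq_zero_or_pos t with rfl | ht
  · simp
  · rw [if_neg ht.ne', ← ENNReal.ofReal_natCast, ← ENNReal.ofReal_mul (by positivity)]
    refine ENNReal.ofReal_le_ofReal ?_
    have ht' : (1 : ℝ) ≤ t := by exact_mod_cast ht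
    have ht₀' : (0 : ℝ) < t₀ := by exact_mod_cast ht₀
    rcases le_total t₀ (2 * t) with h2 | h2
    · have h3 : Real.exp (-(ε * ((t₀ - t : ℕ) : ℝ))) ≤ 1 := by
        rw [Real.exp_le_one_iff]
        have : 0 ≤ ε * ((t₀ - t : ℕ) : ℝ) := by positivity
        linarith
      refine h3.trans ?_
      rw [div_mul_eq_mul_div, one_le_div ht₀']
      exact_mod_cast h2
    · have h3 : (t₀ : ℝ) / 2 ≤ ((t₀ - t : ℕ) : ℝ) := by
        rw [div_le_iff₀ (by norm_num)]
        exact_mod_cast (by omega : t₀ ≤ (t₀ - t) * 2)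
      calc Real.exp (-(ε * ((t₀ - t : ℕ) : ℝ))) ≤ Real.exp (-(ε * (t₀ / 2))) := by gcongr
        _ ≤ 2 / t₀ := h
        _ ≤ 2 / t₀ * t := le_mul_of_one_le_right (by positivity) ht'

end Aggregation

/-! ### A Chernoff bound over disjoint blocks. -/

section Chernoff

variable {X : Type*} [Fintype X]

theorem avg_prod_block {ι κ : Type*} [Fintype ι] [DecidableEq ι] [Fintype κ] [DecidableEq κ]
    (d : X → ℝ) (g : ι → (κ → X) → ℝ) :
    avg d (fun S : ι × κ → X => ∏ i, g i fun k => S (i, k)) = ∏ i, avg d (g i) := by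
  unfold avg
  rw [Finset.prod_univ_sum, Fintype.piFinset_univ, ← (Equiv.curry ι κ X).symm.sum_comp]
  refine Finset.sum_congr rfl fun S _ => ?_
  rw [Finset.prod_mul_distrib, Fintype.prod_prod_type]
  rfl

open Classical in
/-- A Chernoff bound: it is unlikely that more than a tenth of the blocks are bad. -/
theorem avg_card_lt_le {κ : Type*} [Fintype κ] [DecidableEq κ] {d : X → ℝ}
    (hd0 : ∀ x, 0 ≤ d x) (hd : ∑ x, d x = 1) (bad : (κ → X) → Prop)
    (hbad : (avg d fun B => if bad B then (1 : ℝ) else 0) ≤ 1 / 2046) (ρ : ℕ) :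
    (avg d fun S : Fin (10 * ρ) × κ → X =>
      if (Finset.univ.filter fun j => ¬ bad fun k => S (j, k)).card < 9 * ρ then (1 : ℝ) else 0)
      ≤ (3 / 4) ^ (10 * ρ) := by
  -- Exponential Markov with weight `1024 = 2 ^ 10` per bad block: more than `ρ` bad blocks give at
  -- least `2 ^ (10 ρ)`. The threshold `1/2046` makes the mean weight of a block at most `3/2`.
  calc _ ≤ avg d fun S : Fin (10 * ρ) × κ → X => (1 / 2 : ℝ) ^ (10 * ρ) *
        ∏ j, (1 + 1023 * if bad fun k => S (j, k) then (1 : ℝ) else 0) := by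
        refine avg_mono hd0 fun S => ?_
        have hprod : ∏ j : Fin (10 * ρ), (1 + 1023 * if bad fun k => S (j, k) then (1 : ℝ) else 0)
            = 1024 ^ (Finset.univ.filter fun j => bad fun k => S (j, k)).card := by
          rw [← Finset.prod_const, Finset.prod_filter]
          refine Finset.prod_congr rfl fun j _ => ?_
          split_ifs <;> norm_num
        rw [hprod]
        split_ifs with h
        · have hcard := Finset.card_filter_add_card_filter_not (s := Finset.univ)
            (fun j : Fin (10 * ρ) => bad fun k => S (j, k))
          rw [Finset.card_univ, Fintype.card_fin] at hcard
          calc (1 : ℝ) = (1 / 2) ^ (10 * ρ) * 1024 ^ ρ := by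
                rw [pow_mul, ← mul_pow]; norm_num
            _ ≤ _ := by
                gcongr
                · norm_num
                · omega
        · positivity
    _ = (1 / 2 : ℝ) ^ (10 * ρ) * ∏ _j : Fin (10 * ρ),
          (1 + 1023 * avg d fun B : κ → X => if bad B then (1 : ℝ) else 0) := by
        rw [avg_mul_left, avg_prod_block d fun (_ : Fin (10 * ρ)) (B : κ → X) =>
          1 + 1023 * if bad B then (1 : ℝ) else 0]
        congr 1
        refine Finset.prod_congr rfl fun j _ => ?_
        rw [avg_add, avg_const hd, avg_mul_left]
    _ ≤ (1 / 2 : ℝ) ^ (10 * ρ) * ∏ _j : Fin (10 * ρ), (3 / 2 : ℝ) := by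
        gcongr with j
        · intro _ _
          have : 0 ≤ avg d fun B : κ → X => if bad B then (1 : ℝ) else 0 :=
            avg_nonneg hd0 fun B => by split_ifs <;> norm_num
          linarith
        · linarith
    _ = _ := by
        rw [Finset.prod_const, Finset.card_univ, Fintype.card_fin, ← mul_pow]; norm_num

end Chernoff

/-! ### Real-valued probabilities over finite spaces. -/

section PMFFacts

theorem prob_singleton {A : Type*} (p : PMF A) (a : A) : prob p {a} = (p a).toReal := by
  rw [prob, PMF.toOuterMeasure_apply_singleton]

theorem prob_bind {A B : Type*} [Fintype A] (p : PMF A) (f : A → PMF B) (T : Set B) :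
    prob (p.bind f) T = ∑ a, (p a).toReal * prob (f a) T := by
  rw [prob, PMF.toOuterMeasure_bind_apply, tsum_fintype, ENNReal.toReal_sum]
  · simp_rw [ENNReal.toReal_mul]; rfl
  · exact fun a _ => ENNReal.mul_ne_top (p.apply_ne_top a) (toOuterMeasure_ne_top _ _)

theorem prob_compl {A : Type*} (p : PMF A) (T : Set A) : prob p Tᶜ = 1 - prob p T := by
  have h : p.toOuterMeasure T + p.toOuterMeasure Tᶜ = 1 := by
    rw [PMF.toOuterMeasure_apply, PMF.toOuterMeasure_apply, ← ENNReal.tsum_add, ← p.tsum_coe]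
    exact tsum_congr fun a => congrFun (Set.indicator_self_add_compl T p) a
  have h2 := congrArg ENNReal.toReal h
  rw [ENNReal.toReal_add (toOuterMeasure_ne_top _ _) (toOuterMeasure_ne_top _ _)] at h2
  simp only [ENNReal.toReal_one] at h2
  unfold prob
  linarith

theorem sum_toReal_eq_one {A : Type*} [Fintype A] (p : PMF A) : ∑ a, (p a).toReal = 1 := by
  rw [← ENNReal.toReal_sum fun a _ => p.apply_ne_top a, ← tsum_fintype (L := .unconditional _),
    p.tsum_coe, ENNReal.toReal_one]

theorem sum_toReal_le_one {A : Type*} (p : PMF A) (F : Finset A) :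
    ∑ a ∈ F, (p a).toReal ≤ 1 := by
  rw [← ENNReal.toReal_sum fun a _ => p.apply_ne_top a]
  refine ENNReal.toReal_le_of_le_ofReal zero_le_one ?_
  rw [ENNReal.ofReal_one, ← p.tsum_coe]
  exact ENNReal.sum_le_tsum F

theorem exists_finset_lt_sum {A : Type*} (p : PMF A) {c : ℝ} (hc : c < 1) :
    ∃ F : Finset A, c < ∑ a ∈ F, (p a).toReal := by
  have h1 : ∑' a, (p a).toReal = 1 := by
    rw [← ENNReal.tsum_toReal_eq fun a => p.apply_ne_top a, p.tsum_coe, ENNReal.toReal_one]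
  have h2 : Summable fun a => (p a).toReal := ENNReal.summable_toReal p.tsum_coe_ne_top
  have h3 := h2.hasSum
  rw [h1] at h3
  exact (h3.eventually (lt_mem_nhds hc)).exists

theorem prob_iid_bind {X : Type*} [Fintype X] {Y : Type*} {n : ℕ} (D : PMF X)
    (M : (Fin n → X) → PMF Y) (T : Set Y) :
    prob ((iid D n).bind M) T = avg (fun x => (D x).toReal) fun S => prob (M S) T := by
  rw [prob_bind]
  refine Finset.sum_congr rfl fun S _ => ?_
  rw [iid_apply, ENNReal.toReal_prod]

end PMFFacts

/-! ### The boosted algorithm: privacy and equivalence. -/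

section Boosting

variable {X : Type u} {Y : Type v} {n s : ℕ}

/-- Run `M` on a dataset whose `l`-th point is drawn uniformly from the `l`-th row of `B`. -/
noncomputable def subsample [NeZero s] (M : Algorithm X Y n) (B : Fin n × Fin s → X) : PMF Y :=
  (PMF.uniformOfFintype (Fin n → Fin s)).bind fun I => M fun l => B (l, I l)

theorem prob_subsample [NeZero s] (M : Algorithm X Y n) (B : Fin n × Fin s → X) (T : Set Y) :
    prob (subsample M B) T = subAvg (fun S T => prob (M S) T) B T := by
  rw [subsample, prob_bind, subAvg, Fintype.expect_eq_sum_div_card, Finset.sum_div]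
  refine Finset.sum_congr rfl fun I _ => ?_
  rw [PMF.uniformOfFintype_apply, ENNReal.toReal_inv, ENNReal.toReal_natCast, inv_mul_eq_div]

theorem toReal_subsample [NeZero s] (M : Algorithm X Y n) (B : Fin n × Fin s → X) (y : Y) :
    (subsample M B y).toReal = subAvg (fun S y => (M S y).toReal) B y := by
  rw [← prob_singleton, prob_subsample]
  simp only [subAvg, prob_singleton]

theorem IsDP.finDP {M : Algorithm X Y n} {ε δ : ℝ} (h : IsDP M ε δ) (hδ : 0 ≤ δ) :
    FinDP (fun S y => (M S y).toReal) (Real.exp ε) δ := by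
  intro S S' i hS F
  rw [← ENNReal.ofReal_le_ofReal_iff hδ, ENNReal.ofReal_sum_of_nonneg fun _ _ => le_max_left _ _]
  refine le_trans ?_ (h.tsum_tsub_le hδ hS)
  refine le_trans (Finset.sum_le_sum fun y _ => ?_) (ENNReal.sum_le_tsum F)
  rw [← toReal_tsub_le ((M S).apply_ne_top y)
    (ENNReal.mul_ne_top ENNReal.ofReal_ne_top ((M S').apply_ne_top y)), ENNReal.toReal_mul,
    ENNReal.toReal_ofReal (Real.exp_pos _).le]

/-- Aggregate the subsampled runs of `M` on `10 ρ` disjoint blocks of the data. -/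
noncomputable def boost {N ρ : ℕ} [NeZero s] (M : Algorithm X Y n)
    (φ : Fin (10 * ρ) × (Fin n × Fin s) → Fin N) (ε : ℝ) (η : ℝ≥0∞) (y₀ : Y) (hη : η ≠ 0)
    (htop : ∀ q : Fin (10 * ρ) → PMF Y, ∑' y, aggWeight (stepWeight ε (9 * ρ)) η y₀ q y ≠ ∞) :
    Algorithm X Y N := fun S =>
  aggregate (stepWeight ε (9 * ρ)) η y₀ (fun j => subsample M fun p => S (φ (j, p))) hη (htop _)

theorem isDP_boost {N ρ : ℕ} [NeZero s] (hρ : 0 < ρ) (M : Algorithm X Y n)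
    {φ : Fin (10 * ρ) × (Fin n × Fin s) → Fin N} (hφ : Function.Injective φ) {ε η : ℝ}
    (hε : 0 ≤ ε) (y₀ : Y) (hη : 0 < η) (hη0 : ENNReal.ofReal η ≠ 0)
    (htop : ∀ q : Fin (10 * ρ) → PMF Y,
      ∑' y, aggWeight (stepWeight ε (9 * ρ)) (ENNReal.ofReal η) y₀ q y ≠ ∞) :
    IsDP (boost M φ ε (ENNReal.ofReal η) y₀ hη0 htop) (2 * ε)
      ((Real.exp ε + 1) * Real.exp (-(ε * ((9 * ρ - 1 : ℕ) : ℝ))) / η) := by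
  intro S S' i hS T
  -- The blocks are disjoint, so the changed data point lies in at most one; if it lies in none, any
  -- index will do.
  obtain ⟨j₀, hj₀⟩ : ∃ j₀ : Fin (10 * ρ), ∀ j, j ≠ j₀ → ∀ p, φ (j, p) ≠ i := by
    by_cases h : ∃ q, φ q = i
    · obtain ⟨q, hq⟩ := h
      refine ⟨q.1, fun j hj p hp => hj ?_⟩
      rw [← hq] at hp
      rw [← hφ hp]
    · exact ⟨⟨0, by omega⟩, fun j _ p hp => h ⟨_, hp⟩⟩
  have h := prob_aggregate_le (y₀ := y₀) (Real.one_le_exp hε) (Real.exp_pos _).le hη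
    (stepWeight_zero ε (9 * ρ)) (monotone_stepWeight hε _) (stepWeight_step hε _)
    (stepWeight_one ε (9 * ρ)).le
    (q := fun j => subsample M fun p => S (φ (j, p)))
    (q' := fun j => subsample M fun p => S' (φ (j, p))) (j₀ := j₀)
    (fun j hj => by
      congr 1
      funext p
      exact hS _ (hj₀ j hj p)) hη0 (htop _) (htop _) T
  rw [← Real.exp_nat_mul] at h
  exact_mod_cast h

variable [Fintype X]

theorem avg_prob_subsample_block [NeZero s] {N r : ℕ} (M : Algorithm X Y n) (D : PMF X)
    {φ : Fin r × (Fin n × Fin s) → Fin N} (hφ : Function.Injective φ) (j : Fin r) (T : Set Y) :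
    (avg (fun x => (D x).toReal) fun S : Fin N → X =>
        prob (subsample M fun p => S (φ (j, p))) T)
      = prob ((iid D n).bind M) T := by
  have hd := sum_toReal_eq_one D
  rw [avg_comp_injective hd (φ := fun p => φ (j, p))
    (fun p p' h => (Prod.mk.inj (hφ h)).2) fun B => prob (subsample M B) T, prob_iid_bind]
  simp only [prob_subsample]
  exact avg_subAvg hd (Nat.pos_of_neZero s) (fun S T => prob (M S) T) T

open Classical in
/-- The total mass of the aggregated weights is large unless many blocks are atypical. -/
theorem le_tsum_aggWeight_of_typical {ρ : ℕ} (hρ : 0 < ρ) {ε : ℝ} {η : ℝ≥0∞} {y₀ : Y}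
    (q : Fin (10 * ρ) → PMF Y)
    (htop : ∑' y, aggWeight (stepWeight ε (9 * ρ)) η y₀ q y ≠ ∞)
    {p : Y → ℝ} (hp : ∀ y, 0 ≤ p y) (F : Finset Y) :
    4 / 5 * (∑ y ∈ F, p y - ∑ y ∈ F, p y *
        if (Finset.univ.filter fun j => ¬ (q j y).toReal < 4 / 5 * p y).card < 9 * ρ
          then (1 : ℝ) else 0)
      ≤ (∑' y, aggWeight (stepWeight ε (9 * ρ)) η y₀ q y).toReal := by
  rw [← Finset.sum_sub_distrib, Finset.mul_sum, ← ENNReal.ofReal_le_iff_le_toReal htop]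
  have hnn : ∀ y ∈ F, 0 ≤ 4 / 5 * (p y - p y *
      if (Finset.univ.filter fun j => ¬ (q j y).toReal < 4 / 5 * p y).card < 9 * ρ
        then (1 : ℝ) else 0) := by
    intro y _
    have := hp y
    split_ifs
    · simp
    · simp only [mul_zero, sub_zero]; positivity
  rw [ENNReal.ofReal_sum_of_nonneg hnn]
  refine le_trans (Finset.sum_le_sum fun y _ => ?_) (ENNReal.sum_le_tsum F)
  split_ifs with h
  · simp
  · rw [mul_zero, sub_zero]
    have hset : (Finset.univ.filter fun j => ENNReal.ofReal (4 / 5 * p y) ≤ q j y)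
        = Finset.univ.filter fun j => ¬ (q j y).toReal < 4 / 5 * p y := by
      refine Finset.filter_congr fun j _ => ?_
      rw [not_lt, ENNReal.ofReal_le_iff_le_toReal ((q j).apply_ne_top y)]
    have h2 := le_levelAgg (stepWeight ε (9 * ρ)) (fun j => q j y) (ENNReal.ofReal (4 / 5 * p y))
    rw [hset, stepWeight_of_le (by omega) (not_lt.1 h), mul_one] at h2
    exact h2.trans le_self_add

theorem toReal_tsum_aggWeight_le {ρ : ℕ} {w : ℕ → ℝ≥0∞} {κ η : ℝ} (hκ0 : 0 ≤ κ)
    (hη0 : 0 ≤ η) {y₀ : Y} (hκ : ∀ t : ℕ, w t ≤ ENNReal.ofReal κ * t) (q : Fin ρ → PMF Y)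
    (T : Set Y) :
    (∑' y, T.indicator (aggWeight w (ENNReal.ofReal η) y₀ q) y).toReal
      ≤ κ * ∑ j, prob (q j) T + η := by
  have h := tsum_aggWeight_le (η := ENNReal.ofReal η) (y₀ := y₀) hκ q T
  have h1 := toReal_le_of_le_mul_add hκ0 hη0
    (ENNReal.sum_ne_top.2 fun j _ => toOuterMeasure_ne_top _ _) h
  rwa [ENNReal.toReal_sum fun j _ => toOuterMeasure_ne_top _ _] at h1

-- The bound on the `p`-weighted probabilities of atypical blocks, with Markov's inequality over
-- outputs, leaves mass at most `1/50` on outputs that are too often underestimated. Another `1/50`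
-- is spent on passing to a finite set, since `Y` may be infinite; `24/25` remains.
open Classical in
theorem exists_typical_outputs [NeZero s] (M : Algorithm X Y n) (D : PMF X) {ε δ : ℝ}
    (hε : 0 ≤ ε) (hδ : 0 ≤ δ) (hM : IsDP M ε δ)
    (hsmall : 80 * (n * s * (((Real.exp ε - 1) * Real.exp ε) ^ 2 / s ^ 2 * 2
        + ((Real.exp ε - 1) * Real.exp ε / s ^ 2 + 1 / s) * ((Real.exp ε + 1) * δ)))
          ≤ 1 / 50 / 2046) :
    ∃ F : Finset Y, 24 / 25 ≤ ∑ y ∈ F, ((iid D n).bind M y).toReal ∧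
      ∀ y ∈ F, (avg (fun x => (D x).toReal) fun B : Fin n × Fin s → X =>
        if (subsample M B y).toReal < 4 / 5 * ((iid D n).bind M y).toReal
          then (1 : ℝ) else 0) ≤ 1 / 2046 := by
  set d : X → ℝ := fun x => (D x).toReal with hd
  have hd0 : ∀ x, 0 ≤ d x := fun x => ENNReal.toReal_nonneg
  have hd1 : ∑ x, d x = 1 := sum_toReal_eq_one D
  set p : Y → ℝ := fun y => ((iid D n).bind M y).toReal with hp
  have hp0 : ∀ y, 0 ≤ p y := fun y => ENNReal.toReal_nonneg
  have hpavg : ∀ y, p y = avg d fun S => (M S y).toReal := fun y => by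
    simp only [hp, ← prob_singleton, prob_iid_bind, hd]
  set Q : Y → ℝ := fun y => avg d fun B : Fin n × Fin s → X =>
        if (subsample M B y).toReal < 4 / 5 * p y then (1 : ℝ) else 0 with hQ
  obtain ⟨F, hF⟩ := exists_finset_lt_sum ((iid D n).bind M) (by norm_num : (49 / 50 : ℝ) < 1)
  refine ⟨F.filter fun y => Q y ≤ 1 / 2046, ?_, fun y hy => (Finset.mem_filter.1 hy).2⟩
  have h1 : ∑ y ∈ F, p y * Q y ≤ 1 / 50 / 2046 := by
    have h := sum_mul_avg_lt_le (s := s) hd0 hd1 (Nat.pos_of_neZero s)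
      (a := fun S y => (M S y).toReal) (fun S y => ENNReal.toReal_nonneg)
      (fun S F => sum_toReal_le_one (M S) F) (Real.one_le_exp hε) (hM.finDP hδ) F
    refine le_trans (le_of_eq ?_) (h.trans hsmall)
    refine Finset.sum_congr rfl fun y _ => ?_
    simp only [hQ, toReal_subsample, hpavg]
  have hQ0 : ∀ y, 0 ≤ Q y := fun y => avg_nonneg hd0 fun B => by split_ifs <;> norm_num
  have h2 : ∑ y ∈ F.filter (fun y => ¬ Q y ≤ 1 / 2046), p y ≤ 1 / 50 := by
    calc ∑ y ∈ F.filter (fun y => ¬ Q y ≤ 1 / 2046), p y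
        ≤ ∑ y ∈ F.filter (fun y => ¬ Q y ≤ 1 / 2046), 2046 * (p y * Q y) := by
          refine Finset.sum_le_sum fun y hy => ?_
          have := (Finset.mem_filter.1 hy).2
          nlinarith [hp0 y]
      _ ≤ ∑ y ∈ F, 2046 * (p y * Q y) :=
          Finset.sum_le_sum_of_subset_of_nonneg (Finset.filter_subset _ _) fun y _ _ =>
            mul_nonneg (by norm_num) (mul_nonneg (hp0 y) (hQ0 y))
      _ ≤ 1 / 50 := by rw [← Finset.mul_sum]; linarith
  have h3 := Finset.sum_filter_add_sum_filter_not F (fun y => Q y ≤ 1 / 2046) p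
  change 24 / 25 ≤ ∑ y ∈ F.filter fun y => Q y ≤ 1 / 2046, p y
  change 49 / 50 < ∑ y ∈ F, p y at hF
  linarith

/-- Let `U S` be the `p`-mass of the outputs in `F` that too few blocks support. If it is small, the
normalizer is bounded below by a constant, and the failure probability is at most a constant times
the unnormalized weight of the invalid outputs. That weight is at most linear in the block
probabilities, whose mean is the failure probability of `M` itself. -/
theorem isEquivalent_boost {N ρ : ℕ} [NeZero s] (hρ : 0 < ρ) (M : Algorithm X Y n)
    {φ : Fin (10 * ρ) × (Fin n × Fin s) → Fin N} (hφ : Function.Injective φ) {ε δ ε' β : ℝ}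
    (hε : 0 ≤ ε) (hδ : 0 ≤ δ) (hM : IsDP M ε δ)
    (hsmall : 80 * (n * s * (((Real.exp ε - 1) * Real.exp ε) ^ 2 / s ^ 2 * 2
        + ((Real.exp ε - 1) * Real.exp ε / s ^ 2 + 1 / s) * ((Real.exp ε + 1) * δ)))
          ≤ 1 / 50 / 2046)
    (y₀ : Y) (hβ : 0 < β)
    (hκ : ∀ t : ℕ, stepWeight ε' (9 * ρ) t ≤ ENNReal.ofReal (2 / (9 * ρ : ℕ)) * t)
    (hρβ : 5 * (3 / 4 : ℝ) ^ (10 * ρ) ≤ β)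
    (hη0 : ENNReal.ofReal (β / 100) ≠ 0)
    (htop : ∀ q : Fin (10 * ρ) → PMF Y,
      ∑' y, aggWeight (stepWeight ε' (9 * ρ)) (ENNReal.ofReal (β / 100)) y₀ q y ≠ ∞) :
    IsEquivalent (boost M φ ε' (ENNReal.ofReal (β / 100)) y₀ hη0 htop) M β (5 * β) := by
  classical
  intro T hT D hD
  have hsolve := hT D hD
  set V := T.valid D
  set d : X → ℝ := fun x => (D x).toReal with hd
  have hd0 : ∀ x, 0 ≤ d x := fun x => ENNReal.toReal_nonneg
  have hd1 : ∑ x, d x = 1 := sum_toReal_eq_one D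
  obtain ⟨F, hF, hFtyp⟩ := exists_typical_outputs (s := s) M D hε hδ hM hsmall
  set p : Y → ℝ := fun y => ((iid D n).bind M y).toReal with hp
  have hp0 : ∀ y, 0 ≤ p y := fun y => ENNReal.toReal_nonneg
  let q : (Fin N → X) → Fin (10 * ρ) → PMF Y := fun S j => subsample M fun x => S (φ (j, x))
  let U : (Fin N → X) → ℝ := fun S => ∑ y ∈ F, p y *
    if (Finset.univ.filter fun j => ¬ (q S j y).toReal < 4 / 5 * p y).card < 9 * ρ
      then (1 : ℝ) else 0
  have hU0 : ∀ S, 0 ≤ U S := fun S => Finset.sum_nonneg fun y _ =>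
    mul_nonneg (hp0 y) (by split_ifs <;> norm_num)
  have hU : avg d U ≤ (3 / 4) ^ (10 * ρ) := by
    have h1 : ∀ y ∈ F, (avg d fun S => p y *
        if (Finset.univ.filter fun j => ¬ (q S j y).toReal < 4 / 5 * p y).card < 9 * ρ
          then (1 : ℝ) else 0) ≤ p y * (3 / 4) ^ (10 * ρ) := by
      intro y hy
      rw [avg_mul_left]
      refine mul_le_mul_of_nonneg_left ?_ (hp0 y)
      rw [avg_comp_injective hd1 hφ fun S : Fin (10 * ρ) × (Fin n × Fin s) → X =>
        if (Finset.univ.filter fun j =>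
          ¬ (subsample M (fun x => S (j, x)) y).toReal < 4 / 5 * p y).card < 9 * ρ
          then (1 : ℝ) else 0]
      exact avg_card_lt_le hd0 hd1
        (fun B : Fin n × Fin s → X => (subsample M B y).toReal < 4 / 5 * p y) (hFtyp y hy) ρ
    calc avg d U ≤ ∑ y ∈ F, p y * (3 / 4) ^ (10 * ρ) := by
          rw [avg_sum]; exact Finset.sum_le_sum h1
      _ ≤ 1 * (3 / 4) ^ (10 * ρ) := by
          rw [← Finset.sum_mul]
          gcongr
          exact sum_toReal_le_one _ F
      _ = _ := one_mul _
  have hpt : ∀ S, prob (boost M φ ε' (ENNReal.ofReal (β / 100)) y₀ hη0 htop S) Vᶜ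
      ≤ 5 * U S + 125 / 76 * (2 / (9 * ρ : ℕ) * ∑ j, prob (q S j) Vᶜ + β / 100) := by
    intro S
    have hW := toReal_tsum_aggWeight_le (by positivity) (by positivity) (y₀ := y₀)
      (η := β / 100) hκ (q S) Vᶜ
    have hZ := le_tsum_aggWeight_of_typical hρ (q S) (htop (q S)) hp0 F
    change 4 / 5 * (∑ y ∈ F, p y - U S) ≤ _ at hZ
    have hW0 : 0 ≤ 2 / ((9 * ρ : ℕ) : ℝ) * ∑ j, prob (q S j) Vᶜ + β / 100 :=
      le_trans ENNReal.toReal_nonneg hW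
    -- For `U S ≤ 1/5` the normalizer is at least `4/5 * (24/25 - 1/5) = 76/125`; otherwise `5 * U
    -- S` exceeds one and the bound is trivial.
    rcases le_or_gt (U S) (1 / 5) with h | h
    · have hZ' : (76 / 125 : ℝ) ≤ (∑' y, aggWeight (stepWeight ε' (9 * ρ))
          (ENNReal.ofReal (β / 100)) y₀ (q S) y).toReal := by linarith
      rw [boost, prob_aggregate]
      calc _ ≤ (2 / ((9 * ρ : ℕ) : ℝ) * ∑ j, prob (q S j) Vᶜ + β / 100) / (76 / 125) := by
            gcongr
        _ ≤ _ := by linarith [hU0 S]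
    · have := prob_le_one (boost M φ ε' (ENNReal.ofReal (β / 100)) y₀ hη0 htop S) Vᶜ
      linarith
  have hfail : prob ((iid D N).bind (boost M φ ε' (ENNReal.ofReal (β / 100)) y₀ hη0 htop)) Vᶜ
      ≤ 5 * β := by
    have hcompl : prob ((iid D n).bind M) Vᶜ ≤ β := by rw [prob_compl]; linarith
    have hcompl0 := prob_nonneg ((iid D n).bind M) Vᶜ
    have hρ' : (0 : ℝ) < ρ := by exact_mod_cast hρ
    rw [prob_iid_bind]
    calc _ ≤ avg d fun S => 5 * U S
          + 125 / 76 * (2 / (9 * ρ : ℕ) * ∑ j, prob (q S j) Vᶜ + β / 100) := avg_mono hd0 hpt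
      _ = 5 * avg d U + 125 / 76 * (2 / (9 * ρ : ℕ) *
            ∑ _j : Fin (10 * ρ), prob ((iid D n).bind M) Vᶜ + β / 100) := by
          rw [avg_add, avg_mul_left, avg_mul_left, avg_add, avg_mul_left, avg_const hd1]
          congr 5
          rw [avg_sum]
          exact Finset.sum_congr rfl fun j _ => avg_prob_subsample_block M D hφ j Vᶜ
      -- The factor `20/9` is the product of `10 ρ` blocks and the slope `2 / (9 ρ)`. The first term
      -- will be at most `β` by `hρβ`, and the second is below `4 β`.
      _ = 5 * avg d U + 125 / 76 * (20 / 9 * prob ((iid D n).bind M) Vᶜ + β / 100) := by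
          rw [Finset.sum_const, Finset.card_univ, Fintype.card_fin, nsmul_eq_mul]
          push_cast
          field_simp
          ring
      _ ≤ 5 * β := by linarith
  rw [prob_compl] at hfail
  linarith

end Boosting

/-! ### Choice of parameters and the four axioms together. -/

open Filter Topology in
theorem exists_pow_mul_exp_neg_le {a c : ℝ} (ha : 0 < a) (hc : 0 < c) (m : ℕ) :
    ∃ K₀ : ℝ, ∀ K, K₀ ≤ K → K ^ m * Real.exp (-(a * K)) ≤ c := by
  have h := (Real.tendsto_pow_mul_exp_neg_atTop_nhds_zero m).comp
    (tendsto_id.const_mul_atTop ha)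
  have h2 := h.eventually (ge_mem_nhds (by positivity : 0 < c * a ^ m))
  obtain ⟨K₀, hK₀⟩ := eventually_atTop.1 h2
  refine ⟨K₀, fun K hK => ?_⟩
  have h3 := hK₀ K hK
  simp only [Function.comp_apply, id_eq, mul_pow] at h3
  have ha' : 0 < a ^ m := by positivity
  nlinarith

/-- The numerical facts used for boosting, in terms of the tenth root `K` of the scaling factor. -/
theorem boost_parameters {α K : ℝ} {n k ρ : ℕ} (hα : 0 < α) (hα1 : α ≤ 1) (hn : 0 < n)
    (hK3 : 3 ≤ K) (hk : (k : ℝ) = K ^ 10) (hnK : (n : ℝ) ≤ K) (hρ : ρ = k / (10 * n))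
    (hK : K ^ 59 * Real.exp (-(α / 8 * K)) ≤ α ^ 2 / 400) {ε β : ℝ}
    (hε : ε = α / (2 * K ^ 8)) (hβ : 1 / K ^ 10 ≤ β) :
    0 < ρ ∧ Real.exp (-(ε * ((9 * ρ : ℕ) / 2))) ≤ 2 / (9 * ρ : ℕ) ∧
      5 * (3 / 4 : ℝ) ^ (10 * ρ) ≤ β ∧
      (Real.exp ε + 1) * Real.exp (-(ε * ((9 * ρ - 1 : ℕ) : ℝ))) / (β / 100)
        ≤ (2 * ε) ^ 2 / ((k * n : ℕ) : ℝ) ^ 3 := by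
  have hKpos : 0 < K := by linarith
  have hn' : (1 : ℝ) ≤ n := by exact_mod_cast hn
  have hK8 : (6561 : ℝ) ≤ K ^ 8 := by
    calc (6561 : ℝ) = 3 ^ 8 := by norm_num
      _ ≤ K ^ 8 := by gcongr
  have hK9 : (19683 : ℝ) ≤ K ^ 9 := by
    calc (19683 : ℝ) = 3 ^ 9 := by norm_num
      _ ≤ K ^ 9 := by gcongr
  -- the number of blocks
  have hlow : K ^ 9 ≤ 10 * (ρ + 1) := by
    have h1 : k < 10 * n * (ρ + 1) := by
      rw [hρ]; exact Nat.lt_mul_div_succ k (by omega)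
    have h2 : (k : ℝ) ≤ 10 * n * (ρ + 1) := by exact_mod_cast h1.le
    rw [hk] at h2
    have h3 : K * K ^ 9 ≤ K * (10 * (ρ + 1)) := by
      calc K * K ^ 9 = K ^ 10 := by ring
        _ ≤ (n : ℝ) * (10 * (ρ + 1)) := by linarith
        _ ≤ _ := by gcongr
    exact le_of_mul_le_mul_left h3 hKpos
  have hρpos : 0 < ρ := by
    rcases Nat.eq_zero_or_pos ρ with h | h
    · rw [h] at hlow; norm_num at hlow; linarith
    · exact h
  have hρ' : (1 : ℝ) ≤ ρ := by exact_mod_cast hρpos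
  have hup : 10 * (ρ : ℝ) ≤ K ^ 10 := by
    rw [← hk]
    have h1 : 10 * n * ρ ≤ k := by rw [hρ]; exact Nat.mul_div_le k (10 * n)
    have h2 : 10 * 1 * ρ ≤ 10 * n * ρ := by gcongr; exact hn
    exact_mod_cast (by omega : 10 * ρ ≤ k)
  have h9cast : ((9 * ρ - 1 : ℕ) : ℝ) = 9 * ρ - 1 := by
    rw [Nat.cast_sub (by omega)]; push_cast; ring
  have hε0 : 0 ≤ ε := by rw [hε]; positivity
  have hεK : ε * K ^ 9 = α / 2 * K := by rw [hε]; field_simp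
  have hε1 : ε ≤ 1 := by
    rw [hε, div_le_one (by positivity)]; linarith
  have hαK : 0 ≤ α * K := by positivity
  -- A common bound for all three exponentials: there are about `K ^ 9 / 10` or more groups of ten
  -- blocks, and `ε * (K ^ 9 / 4) = α / 8 * K`.
  set x := Real.exp (-(α / 8 * K)) with hx
  have hx0 : 0 < x := Real.exp_pos _
  have hpow : ∀ m ≤ 59, K ^ m * x ≤ α ^ 2 / 400 := fun m hm =>
    le_trans (by gcongr; linarith) hK
  have hα2 : α ^ 2 ≤ 1 := pow_le_one₀ hα.le hα1
  refine ⟨hρpos, ?_, ?_, ?_⟩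
  · have h1 : Real.exp (-(ε * ((9 * ρ : ℕ) / 2))) ≤ x := by
      rw [hx]
      refine Real.exp_le_exp.2 (neg_le_neg ?_)
      push_cast
      have : ε * (K ^ 9 / 4) ≤ ε * (9 * ρ / 2) :=
        mul_le_mul_of_nonneg_left (by linarith) hε0
      linarith
    refine h1.trans ?_
    rw [le_div_iff₀ (by positivity)]
    have h2 := hpow 10 (by norm_num)
    have h3 : x * ((9 * ρ : ℕ) : ℝ) ≤ x * K ^ 10 := by gcongr; push_cast; linarith
    linarith
  · have h1 : (3 / 4 : ℝ) ≤ Real.exp (-(1 / 4)) := by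
      linarith [Real.add_one_le_exp (-(1 / 4) : ℝ)]
    have h2 : (3 / 4 : ℝ) ^ (10 * ρ) ≤ x := by
      calc (3 / 4 : ℝ) ^ (10 * ρ) ≤ Real.exp (-(1 / 4)) ^ (10 * ρ) := by gcongr
        _ = Real.exp (((10 * ρ : ℕ) : ℝ) * (-(1 / 4))) := (Real.exp_nat_mul _ _).symm
        _ ≤ x := by
          rw [hx]
          refine Real.exp_le_exp.2 ?_
          push_cast
          have h3 : α * K ≤ 1 * K := by gcongr
          have h4 : K * 6561 ≤ K * K ^ 8 := by gcongr
          have h5 : K * K ^ 8 = K ^ 9 := by ring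
          linarith
    refine le_trans ?_ hβ
    rw [le_div_iff₀ (by positivity)]
    have h3 := hpow 10 (by norm_num)
    have h4 : (3 / 4 : ℝ) ^ (10 * ρ) * K ^ 10 ≤ x * K ^ 10 := by gcongr
    linarith
  · have h1 : Real.exp (-(ε * ((9 * ρ - 1 : ℕ) : ℝ))) ≤ x := by
      rw [hx, h9cast]
      refine Real.exp_le_exp.2 (neg_le_neg ?_)
      have : ε * (K ^ 9 / 4) ≤ ε * (9 * ρ - 1) := by gcongr; linarith
      linarith
    have h2 : Real.exp ε + 1 ≤ 4 := by
      have := (Real.exp_le_exp.2 hε1).trans (Real.exp_one_lt_d9.le)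
      linarith
    have h3 : 1 / (β / 100) ≤ 100 * K ^ 10 := by
      rw [one_div_div, div_le_iff₀ (lt_of_lt_of_le (by positivity) hβ)]
      have h4 : K ^ 10 * (1 / K ^ 10) ≤ K ^ 10 * β := by gcongr
      rw [mul_one_div_cancel (by positivity)] at h4
      linarith
    have hβpos : 0 < β := lt_of_lt_of_le (by positivity) hβ
    calc (Real.exp ε + 1) * Real.exp (-(ε * ((9 * ρ - 1 : ℕ) : ℝ))) / (β / 100)
        = (Real.exp ε + 1) * Real.exp (-(ε * ((9 * ρ - 1 : ℕ) : ℝ))) * (1 / (β / 100)) := by ring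
      _ ≤ 4 * x * (100 * K ^ 10) := by gcongr
      -- The target is of order `K ^ (-49)`: `16` powers from the squared level and `33` from the
      -- cubed sample size. Ten further powers, from `1 / β`, account for the exponent `59`.
      _ = 400 * (K ^ 59 * x) / K ^ 49 := by field_simp; norm_num
      _ ≤ 400 * (α ^ 2 / 400) / K ^ 49 := by gcongr
      _ = (2 * ε) ^ 2 / (K ^ 10 * K) ^ 3 := by rw [hε]; field_simp
      _ ≤ _ := by
          push_cast
          rw [hk]
          gcongr

/-- With `n` columns per row, the `n ^ 2` points each contribute about `α ^ 2 / n ^ 2`, so the total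
is of order `α ^ 2` uniformly in `n`. The numerical smallness of `α` is what makes it fall below the
threshold. -/
theorem subsampling_loss_le {α : ℝ} {n : ℕ} (hα : 0 ≤ α) (hα1 : α ≤ 1 / 10000) (hn : 0 < n) :
    80 * (n * n * (((Real.exp α - 1) * Real.exp α) ^ 2 / (n : ℝ) ^ 2 * 2
        + ((Real.exp α - 1) * Real.exp α / (n : ℝ) ^ 2 + 1 / n)
          * ((Real.exp α + 1) * (α ^ 2 / (n : ℝ) ^ 3)))) ≤ 1 / 50 / 2046 := by
  have hn' : (1 : ℝ) ≤ n := by exact_mod_cast hn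
  have he1 : 1 ≤ Real.exp α := Real.one_le_exp hα
  have hexp : Real.exp α ≤ 1 + α + α ^ 2 := by
    have h := Real.abs_exp_sub_one_sub_id_le (x := α) (by rw [abs_of_nonneg hα]; linarith)
    linarith [le_abs_self (Real.exp α - 1 - α)]
  have hτ0 : 0 ≤ (Real.exp α - 1) * Real.exp α := mul_nonneg (by linarith) (by linarith)
  have hα2 : α ^ 2 ≤ (1 / 10000) * α := by nlinarith
  have hτ : (Real.exp α - 1) * Real.exp α ≤ 11 / 10 * α := by
    have h1 : Real.exp α - 1 ≤ 10001 / 10000 * α := by linarith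
    have h2 : Real.exp α ≤ 1001 / 1000 := by linarith
    calc (Real.exp α - 1) * Real.exp α ≤ (10001 / 10000 * α) * (1001 / 1000) := by gcongr
      _ ≤ _ := by nlinarith
  have he : Real.exp α + 1 ≤ 21 / 10 := by linarith
  set τ := (Real.exp α - 1) * Real.exp α
  have hn2 : α ^ 2 / (n : ℝ) ^ 2 ≤ α ^ 2 := div_le_self (by positivity) (one_le_pow₀ hn')
  calc _ = 80 * (2 * τ ^ 2 + (τ / n + 1) * ((Real.exp α + 1) * (α ^ 2 / (n : ℝ) ^ 2))) := by
        field_simp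
    _ ≤ 80 * (2 * (11 / 10 * α) ^ 2 + (1 / 1 + 1) * (21 / 10 * α ^ 2)) := by
        gcongr
        linarith
    _ ≤ 80 * (7 * (1 / 10000) ^ 2) := by
        have : α ^ 2 ≤ (1 / 10000) ^ 2 := by gcongr
        nlinarith
    _ ≤ _ := by norm_num

theorem linearScalability_dpMeasure {α : ℝ≥0} (hα : 0 < α) (hα1 : α ≤ 1 / 10000) :
    ∃ Δ : ℝ, 1 ≤ Δ ∧ LinearScalability (dpMeasure.{u, v} α)
      (MvPolynomial.C Δ * MvPolynomial.X 0 ^ 10 * MvPolynomial.X 1) 5 := by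
  have hα' : (0 : ℝ) < α := by exact_mod_cast hα
  have hα1' : (α : ℝ) ≤ 1 / 10000 := by
    have : ((α : ℝ≥0) : ℝ) ≤ ((1 / 10000 : ℝ≥0) : ℝ) := by exact_mod_cast hα1
    simpa using this
  obtain ⟨K₀, hK₀⟩ := exists_pow_mul_exp_neg_le (a := (α : ℝ) / 8) (c := (α : ℝ) ^ 2 / 400)
    (by positivity) (by positivity) 59
  set K₁ : ℝ := max K₀ 3 with hK₁
  have hK₁3 : 3 ≤ K₁ := le_max_right _ _
  have hΔ : 1 ≤ K₁ ^ 10 := one_le_pow₀ (by linarith)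
  -- The bound on `k` yields at once `K ≥ K₁`, `K ≥ n` and `K ^ 10 ≥ 1 / β` for the tenth root `K`
  -- of `k`.
  refine ⟨K₁ ^ 10, hΔ, 1, ?_⟩
  intro X Y n _ hn M hM β hβ hβ1 k hk hpk
  have hn' : (1 : ℝ) ≤ n := by exact_mod_cast hn
  have hMdp := isDP_of_dpLevel_le ((dpMeasure_le_one_iff hα).1 hM)
  simp only [map_mul, MvPolynomial.eval_C, map_pow, MvPolynomial.eval_X,
    Matrix.cons_val_zero, Matrix.cons_val_one] at hpk
  have hpow1 : (1 : ℝ) ≤ (n : ℝ) ^ 10 := one_le_pow₀ hn'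
  have hβinv : 1 ≤ 1 / β := by rwa [one_le_div hβ]
  have hk1 : K₁ ^ 10 ≤ k := by
    calc K₁ ^ 10 = K₁ ^ 10 * 1 * 1 := by ring
      _ ≤ K₁ ^ 10 * (n : ℝ) ^ 10 * (1 / β) := by gcongr
      _ ≤ k := hpk
  have hk2 : (n : ℝ) ^ 10 ≤ k := by
    calc (n : ℝ) ^ 10 = 1 * (n : ℝ) ^ 10 * 1 := by ring
      _ ≤ K₁ ^ 10 * (n : ℝ) ^ 10 * (1 / β) := by gcongr
      _ ≤ k := hpk
  have hk3 : 1 / β ≤ k := by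
    calc 1 / β = 1 * 1 * (1 / β) := by ring
      _ ≤ K₁ ^ 10 * (n : ℝ) ^ 10 * (1 / β) := by gcongr
      _ ≤ k := hpk
  set K : ℝ := (k : ℝ) ^ (1 / 10 : ℝ) with hKdef
  have hK0 : 0 ≤ K := by positivity
  have hkK : (k : ℝ) = K ^ 10 := by
    rw [hKdef, ← Real.rpow_natCast, ← Real.rpow_mul (by positivity)]; norm_num
  rw [hkK] at hk1 hk2 hk3
  have hK₁K : K₁ ≤ K := le_of_pow_le_pow_left₀ (by norm_num) hK0 hk1
  have hnK : (n : ℝ) ≤ K := le_of_pow_le_pow_left₀ (by norm_num) hK0 hk2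
  have hK3 : 3 ≤ K := hK₁3.trans hK₁K
  have hKpos : 0 < K := by linarith
  have hβK : 1 / K ^ 10 ≤ β := by
    rw [div_le_iff₀ (by positivity)]; rw [div_le_iff₀ hβ] at hk3; linarith
  -- Half of the target level, because normalization doubles it; `(K ^ (-8)) ^ (5/4) = K ^ (-10)` is
  -- then `1 / k`.
  set ε : ℝ := α / (2 * K ^ 8) with hε
  have hε0 : 0 ≤ ε := by positivity
  obtain ⟨hρ, hκ, hρβ, hδ⟩ := boost_parameters hα' (by linarith) hn hK3 hkK hnK rfl
    (hK₀ K ((le_max_left _ _).trans hK₁K)) hε hβK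
  set ρ := k / (10 * n) with hρdef
  suffices h : ∃ M' : Algorithm X Y (k * n), IsEquivalent M' M β (5 * β) ∧
      IsDP M' (2 * ε) ((2 * ε) ^ 2 / ((k * n : ℕ) : ℝ) ^ 3) by
    obtain ⟨M', h1, h2⟩ := h
    refine ⟨M', h1, ?_⟩
    have hlevel : dpLevel M' ≤ α / (K.toNNReal) ^ 8 := by
      refine dpLevel_le ?_
      have h3 : ((α / (K.toNNReal) ^ 8 : ℝ≥0) : ℝ) = 2 * ε := by
        push_cast
        rw [Real.coe_toNNReal K hK0, hε]
        field_simp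
      rw [h3]
      exact h2
    have hKnn : (k : ℝ≥0) = K.toNNReal ^ 10 := by
      rw [← NNReal.coe_inj]; push_cast; rw [Real.coe_toNNReal K hK0]; exact hkK
    have hKnn0 : K.toNNReal ≠ 0 := by simpa using hKpos
    calc (dpLevel M' / α) ^ (5 / 4 : ℝ) ≤ ((α / (K.toNNReal) ^ 8) / α) ^ (5 / 4 : ℝ) := by gcongr
      _ = ((K.toNNReal ^ 8)⁻¹) ^ (5 / 4 : ℝ) := by
          congr 1; field_simp
      _ = 1 / k := by
          rw [hKnn, NNReal.inv_rpow, ← NNReal.rpow_natCast, ← NNReal.rpow_mul,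
            ← NNReal.rpow_natCast, one_div]
          norm_num
  -- Over an empty domain there are no datasets and no distributions. Otherwise some output `y₀`
  -- exists to carry the extra weight of the normalizer.
  rcases isEmpty_or_nonempty X with hX | ⟨⟨x₀⟩⟩
  · have hkn : 0 < k * n := Nat.mul_pos hk hn
    refine ⟨fun S => hX.elim (S ⟨0, hkn⟩), fun T _ D _ => ?_, fun S => hX.elim (S ⟨0, hkn⟩)⟩
    exact hX.elim D.support_nonempty.some
  · have := Fintype.ofFinite X
    have : NeZero n := ⟨hn.ne'⟩
    obtain ⟨y₀, -⟩ := (M fun _ => x₀).support_nonempty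
    obtain ⟨φ⟩ : Nonempty (Fin (10 * ρ) × (Fin n × Fin n) ↪ Fin (k * n)) := by
      refine Function.Embedding.nonempty_of_card_le ?_
      simp only [Fintype.card_prod, Fintype.card_fin]
      calc 10 * ρ * (n * n) = 10 * n * ρ * n := by ring
        _ ≤ k * n := Nat.mul_le_mul_right n (Nat.mul_div_le k (10 * n))
    have hκ' := stepWeight_le_mul (t₀ := 9 * ρ) hε0 (by omega) hκ
    have hη0 : ENNReal.ofReal (β / 100) ≠ 0 := by
      rw [ne_eq, ENNReal.ofReal_eq_zero, not_le]; positivity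
    have htop : ∀ q : Fin (10 * ρ) → PMF Y,
        ∑' y, aggWeight (stepWeight ε (9 * ρ)) (ENNReal.ofReal (β / 100)) y₀ q y ≠ ∞ :=
      tsum_aggWeight_ne_top hκ' ENNReal.ofReal_ne_top ENNReal.ofReal_ne_top
    refine ⟨boost M φ ε (ENNReal.ofReal (β / 100)) y₀ hη0 htop, ?_, ?_⟩
    · exact isEquivalent_boost hρ M φ.injective α.2 (by positivity) hMdp
        (subsampling_loss_le α.2 hα1' hn) y₀ hβ hκ' hρβ hη0 htop
    · exact (isDP_boost hρ M φ.injective hε0 y₀ (by positivity) hη0 htop).mono le_rfl hδ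

end PrivacyAxioms

open PrivacyAxioms in
theorem theorem2 :
    ∃ α₀ : ℝ≥0, 0 < α₀ ∧ α₀ ≤ 1 / 10 ∧ ∀ α : ℝ≥0, 0 < α → α ≤ α₀ →
      Preprocessing (dpMeasure.{u, v} α) ∧
      ProhibitsBlatantNonPrivacy (dpMeasure.{u, v} α) ∧
      StrongComposition (dpMeasure.{u, v} α) (5 / 8) ∧
      ∃ Δ : ℝ, 1 ≤ Δ ∧
        LinearScalability (dpMeasure.{u, v} α)
          (MvPolynomial.C Δ * MvPolynomial.X 0 ^ 10 * MvPolynomial.X 1) 5 := by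
  have h10 : (1 / 10000 : ℝ≥0) ≤ 1 / 10 := by
    rw [div_le_div_iff₀ (by norm_num) (by norm_num)]; norm_num
  have h1 : (1 / 10 : ℝ≥0) ≤ 1 := by rw [div_le_one (by norm_num)]; norm_num
  -- Scalability alone requires the bound `1 / 10000`; the other axioms hold for all positive `α` up
  -- to `1 / 10`.
  refine ⟨1 / 10000, by positivity, h10, fun α hα hα₀ => ⟨preprocessing_dpMeasure α,
    prohibitsBlatantNonPrivacy_dpMeasure hα (hα₀.trans h10),
    strongComposition_dpMeasure hα ((hα₀.trans h10).trans h1),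
    linearScalability_dpMeasure hα hα₀⟩⟩
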